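/- Let $n\ge 2$, $X\in\mathbb R^{n\times p}$, $y\in\mathbb R^n$, let $\{\mathcal G_l\}_{l=1}^g$ be a partition of $\{1,\dots,p\}$ with weights $\omega_l>0$, and let $\lambda,\sigma,\tau>0$. Put $$L(s)=\frac1{n(n-1)}\sum_{i=1}^n\sum_{j\ne i}|s_i-s_j|\ (s\in\mathbb R^n),\qquad \Psi(\beta)=\sum_{l=1}^g\omega_l\|\beta_{\mathcal G_l}\|_2\ (\beta\in\mathbb R^p),$$ $$l(w;s,\beta)=\langle y,w\rangle-L(s)-\lambda\Psi(\beta)+\langle s,w\rangle-\langle\beta,X^\top w\rangle,$$ $$\mathcal L_\sigma(w;s,\beta)=\sup_{\nu\in\mathbb R^n,\ \phi\in\mathbb R^p}\Big\{l(w;\nu,\phi)-\tfrac1{2\sigma}\|\nu-s\|_2^2-\tfrac1{2\sigma}\|\phi-\beta\|_2^2\Big\}.$$ For given $w^k,s^k\in\mathbb R^n$ and $\beta^k\in\mathbb R^p$, let $$\psi(w)=\mathcal L_\sigma(w;s^k,\beta^k)+\tfrac{\tau}{2\sigma}\|w-w^k\|_2^2,\qquad w\in\mathbb R^n.$$ For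 a convex function $f$ write $\operatorname{Prox}_f(x)=\arg\min_u\{f(u)+\frac12\|u-x\|_2^2\}$, and write $\partial\operatorname{Prox}_f(x)$ for the Clarke generalized Jacobian of $\operatorname{Prox}_f$ at $x$. Let $\bar\mu\in(0,\frac12)$, $\bar\eta\in(0,1)$, $\bar\tau\in(0,1]$, $\bar\delta\in(0,1)$, and let $\{w^{(j)}\}_{j\ge0}$ be any sequence generated by the following semismooth Newton method (run without a termination test): $w^{(0)}=w^k$, and for $j=0,1,2,\dots$ 1. choose $\Lambda^{(j)}\in\partial\operatorname{Prox}_L(s^k/\sigma+w^{(j)})$ and $V^{(j)}\in\partial\operatorname{Prox}_\Psi(\beta^k/(\sigma\lambda)-X^\top w^{(j)}/\lambda)$, set $H^{(j)}=\sigma\Lambda^{(j)}+\sigma XV^{(j)}X^\top+\frac\tau\sigma I_n$, and let $d^{(j)}$ be the exact solution of $H^{(j)}d=-\nabla\psi(w^{(j)})$, or an iterate of the conjugate gradient method for this system with starting point $0$, such that $$\|H^{(j)}d^{(j)}+\nabla\psi(w^{(j)})\|_2\le\min\{\bar\eta,\ \|\nabla\psi(w^{(j)})\|_2^{1+\bar\tau}\};$$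 2. let $m_j$ be the first nonnegative integer $m$ with $\psi(w^{(j)}+\bar\delta^m d^{(j)})\le\psi(w^{(j)})+\bar\mu\,\bar\delta^m\langle\nabla\psi(w^{(j)}),d^{(j)}\rangle$; 3. set $w^{(j+1)}=w^{(j)}+\bar\delta^{m_j}d^{(j)}$. Then $\psi$ has a unique minimizer $\bar w$ over $\mathbb R^n$, the sequence $\{w^{(j)}\}$ converges to $\bar w$, and $$\|w^{(j+1)}-\bar w\|_2=O\big(\|w^{(j)}-\bar w\|_2^{1+\bar\tau}\big)\qquad(j\to\infty).$$ -/

import Mathlib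

open Filter Topology

noncomputable section

namespace RankSSN

/-- Real coordinate space `ℝⁿ` with the Euclidean norm. -/
abbrev Vec (n : ℕ) : Type := EuclideanSpace ℝ (Fin n)

/-- The linear map `v ↦ A v` given by a real matrix `A`. -/
def matMap {m n : ℕ} (A : Matrix (Fin m) (Fin n) ℝ) : Vec n →L[ℝ] Vec m :=
  LinearMap.toContinuousLinearMap (Matrix.toEuclideanLin A)

/-- The Wilcoxon rank loss `L(v) = 1/(n(n-1)) ∑ᵢ ∑_{j ≠ i} |vᵢ - vⱼ|`. -/
def rankLoss {n : ℕ} (v : Vec n) : ℝ :=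
  1 / ((n : ℝ) * ((n : ℝ) - 1)) * ∑ i, ∑ j ∈ Finset.univ.erase i, |v i - v j|

/-- The group lasso regularizer `Ψ(β) = ∑ₗ ωₗ ‖β_{Gₗ}‖₂`. -/
def groupLasso {p g : ℕ} (G : Fin g → Finset (Fin p)) (ω : Fin g → ℝ) (β : Vec p) : ℝ :=
  ∑ l, ω l * Real.sqrt (∑ i ∈ G l, β i ^ 2)

/-- The proximal mapping `Prox_f(x)`: the minimizer of `f(u) + ½‖u - x‖²`
(which exists and is unique for a finite convex function `f` on `ℝⁿ`). -/
def prox {n : ℕ} (f : Vec n → ℝ) (x : Vec n) : Vec n :=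
  Classical.epsilon fun u : Vec n =>
    IsMinOn (fun v : Vec n => f v + 1 / 2 * ‖v - x‖ ^ 2) Set.univ u

/-- The Bouligand subdifferential: all limits of derivatives `F'(u_k)` along sequences
`u_k → x` of points at which `F` is differentiable. -/
def bouligand {m n : ℕ} (F : Vec m → Vec n) (x : Vec m) : Set (Vec m →L[ℝ] Vec n) :=
  {A | ∃ u : ℕ → Vec m, (∀ k, DifferentiableAt ℝ F (u k)) ∧ Tendsto u atTop (𝓝 x) ∧
    Tendsto (fun k => fderiv ℝ F (u k)) atTop (𝓝 A)}

/-- The Clarke generalized Jacobian: the convex hull of the Bouligand subdifferential. -/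
def clarke {m n : ℕ} (F : Vec m → Vec n) (x : Vec m) : Set (Vec m →L[ℝ] Vec n) :=
  convexHull ℝ (bouligand F x)

/-- The Lagrangian
`l(w; s, β) = ⟨y, w⟩ - L(s) - λ Ψ(β) + ⟨s, w⟩ - ⟨β, Xᵀ w⟩`
of the dual of the group lasso regularized rank regression problem. -/
def lagrangian {n p g : ℕ} (X : Matrix (Fin n) (Fin p) ℝ) (y : Vec n)
    (G : Fin g → Finset (Fin p)) (ω : Fin g → ℝ) (lam : ℝ)
    (w s : Vec n) (β : Vec p) : ℝ :=
  inner ℝ y w - rankLoss s - lam * groupLasso G ω β + inner ℝ s w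
    - inner ℝ β (matMap X.transpose w)

/-- The augmented Lagrangian
`𝓛_σ(w; s, β) = sup_{ν, φ} { l(w; ν, φ) - ‖ν - s‖²/(2σ) - ‖φ - β‖²/(2σ) }`. The supremum is
over a set bounded above when `σ > 0`, `λ ≥ 0` and `ω ≥ 0`. -/
def augLagrangian {n p g : ℕ} (X : Matrix (Fin n) (Fin p) ℝ) (y : Vec n)
    (G : Fin g → Finset (Fin p)) (ω : Fin g → ℝ) (lam σ : ℝ)
    (w s : Vec n) (β : Vec p) : ℝ :=
  ⨆ q : Vec n × Vec p, (lagrangian X y G ω lam w q.1 q.2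
    - 1 / (2 * σ) * ‖q.1 - s‖ ^ 2 - 1 / (2 * σ) * ‖q.2 - β‖ ^ 2)

/-- The objective of the proximal augmented Lagrangian subproblem at the current outer iterate
`(wk, sk, βk)`: `ψ(w) = 𝓛_σ(w; sk, βk) + τ/(2σ) ‖w - wk‖²`. -/
def psi {n p g : ℕ} (X : Matrix (Fin n) (Fin p) ℝ) (y : Vec n)
    (G : Fin g → Finset (Fin p)) (ω : Fin g → ℝ) (lam σ τ : ℝ)
    (wk sk : Vec n) (βk : Vec p) (w : Vec n) : ℝ :=
  augLagrangian X y G ω lam σ w sk βk + τ / (2 * σ) * ‖w - wk‖ ^ 2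

/-- The generalized Hessian set
`σ ∂Prox_L(sk/σ + w) + σ X ∂Prox_Ψ(βk/(σλ) - Xᵀw/λ) Xᵀ + (τ/σ) I`. -/
def genHessian {n p g : ℕ} (X : Matrix (Fin n) (Fin p) ℝ)
    (G : Fin g → Finset (Fin p)) (ω : Fin g → ℝ) (lam σ τ : ℝ)
    (sk : Vec n) (βk : Vec p) (w : Vec n) : Set (Vec n →L[ℝ] Vec n) :=
  {H | ∃ Λ ∈ clarke (prox (rankLoss (n := n))) ((1 / σ) • sk + w),
    ∃ V ∈ clarke (prox (groupLasso G ω))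
        ((1 / (σ * lam)) • βk - (1 / lam) • matMap X.transpose w),
      H = σ • Λ + σ • ((matMap X).comp (V.comp (matMap X.transpose)))
        + (τ / σ) • ContinuousLinearMap.id ℝ (Vec n)}

/-- The state of the conjugate gradient method: the iterate, the residual and the search
direction. -/
structure CGState (n : ℕ) where
  x : Vec n
  r : Vec n
  q : Vec n

/-- One conjugate gradient step for `A x = b`. Once the residual vanishes, the step leaves the
iterate unchanged. -/
def cgStep {n : ℕ} (A : Vec n →L[ℝ] Vec n) (c : CGState n) : CGState n :=
  let a : ℝ := inner ℝ c.r c.r / inner ℝ c.q (A c.q)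
  let r' : Vec n := c.r - a • A c.q
  { x := c.x + a • c.q
    r := r'
    q := r' + (inner ℝ r' r' / inner ℝ c.r c.r : ℝ) • c.q }

/-- The `i`-th iterate of the conjugate gradient method for `A x = b` with starting point `0`. -/
def cgIterate {n : ℕ} (A : Vec n →L[ℝ] Vec n) (b : Vec n) (i : ℕ) : Vec n :=
  ((cgStep A)^[i] { x := 0, r := b, q := b }).x

/-- `d` solves `H d = -v` exactly, or is a conjugate gradient iterate for this system, and
satisfies `‖H d + v‖ ≤ min {η, ‖v‖^(1 + θ)}`. -/
def IsNewtonDirection {n : ℕ} (H : Vec n →L[ℝ] Vec n) (v : Vec n) (η θ : ℝ) (d : Vec n) : Prop :=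
  (H d = -v ∨ ∃ i, d = cgIterate H (-v) i) ∧ ‖H d + v‖ ≤ min η (‖v‖ ^ (1 + θ))

/-- `m` is the first nonnegative integer for which the Armijo condition
`f(w + δᵐ d) ≤ f(w) + μ δᵐ ⟨∇f(w), d⟩` holds. -/
def IsArmijoExponent {n : ℕ} (f : Vec n → ℝ) (w d : Vec n) (μ δ : ℝ) (m : ℕ) : Prop :=
  IsLeast {k : ℕ | f (w + δ ^ k • d) ≤ f w + μ * δ ^ k * inner ℝ (gradient f w) d} m

/-- `w` is a sequence generated by the semismooth Newton method for minimizing `ψ`, started at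
`wk`, with parameters `μ, η, θ, δ`, run without its termination test. -/
structure IsSSNSequence {n p g : ℕ} (X : Matrix (Fin n) (Fin p) ℝ) (y : Vec n)
    (G : Fin g → Finset (Fin p)) (ω : Fin g → ℝ) (lam σ τ : ℝ)
    (wk sk : Vec n) (βk : Vec p) (μ η θ δ : ℝ) (w : ℕ → Vec n) : Prop where
  init : w 0 = wk
  step : ∀ j, ∃ H ∈ genHessian X G ω lam σ τ sk βk (w j), ∃ d : Vec n, ∃ m : ℕ,
    IsNewtonDirection H (gradient (psi X y G ω lam σ τ wk sk βk) (w j)) η θ d ∧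
    IsArmijoExponent (psi X y G ω lam σ τ wk sk βk) (w j) d μ δ m ∧
    w (j + 1) = w j + δ ^ m • d

end RankSSN

end

noncomputable section

namespace RankSSN

/-! Substituting `ν = σν'`, `φ = σλφ'` and using the homogeneity of `L` and `Ψ` splits the supremum
in `ψ` into two conjugates of functions `f + ½‖·‖²`. Such a conjugate is convex with gradient
`Prox_f`, which is 1-Lipschitz. Hence `ψ` is strongly convex with modulus `m = τ/σ`, and `∇ψ` is
Lipschitz. Clarke Jacobians of proximal maps consist of symmetric operators with spectrum in `[0,
1]`, so generalized Hessians are symmetric with spectrum in some `[m, M]`.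

Global convergence: exact solutions and accepted conjugate gradient iterates satisfy `-⟨∇ψ, d⟩ ≥
c‖∇ψ‖²` and `‖d‖ ≤ (2/m)‖∇ψ‖` (`IsNewtonDirection.descent`). Armijo steps are then bounded below
away from critical points, and the gap `ψ - min ψ` contracts by a fixed factor (`armijo_decrease`,
`tendsto_of_gap_contraction`).

Local rate: strong semismoothness enters through `SegmentAffineAt`, whose error carries a factor `1
- t`. Dividing by `1 - t` and letting `t → 1` gives the Clarke Jacobian estimate
(`clarke_estimate`), hence order `1 + θ` for full steps. Integrating along the segment gives a
second order lower bound on the gap (`half_inner_le_gap`), which with `μ < 1/2` makes the line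
search accept the full step near the minimizer (`newton_local`). `Prox_L` has the property because
`L` is polyhedral (`segmentAffineAt_prox_sumAbs`); `Prox_Ψ` has it because block soft thresholding
is built from `C²` functions, `max · 0` and products (`segmentAffineAt_prox_groupLasso`). -/

/-- The states of the conjugate gradient method started at `0`. -/
def cgSeq {n : ℕ} (A : Vec n →L[ℝ] Vec n) (b : Vec n) (k : ℕ) : CGState n :=
  (cgStep A)^[k] { x := 0, r := b, q := b }

/-! ### Conjugate gradients: orthogonality and the angle condition -/

section CG

variable {n : ℕ} (A : Vec n →L[ℝ] Vec n) (b : Vec n)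

/-- The step length of the conjugate gradient method. -/
def cgAlpha (k : ℕ) : ℝ :=
  inner ℝ (cgSeq A b k).r (cgSeq A b k).r / inner ℝ (cgSeq A b k).q (A (cgSeq A b k).q)

/-- The coefficient of the previous direction in the conjugate gradient method. -/
def cgBeta (k : ℕ) : ℝ :=
  inner ℝ (cgSeq A b (k + 1)).r (cgSeq A b (k + 1)).r /
    inner ℝ (cgSeq A b k).r (cgSeq A b k).r

lemma cgSeq_succ (k : ℕ) : cgSeq A b (k + 1) = cgStep A (cgSeq A b k) :=
  Function.iterate_succ_apply' _ _ _

lemma cgSeq_succ_x (k : ℕ) :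
    (cgSeq A b (k + 1)).x = (cgSeq A b k).x + cgAlpha A b k • (cgSeq A b k).q := by
  rw [cgSeq_succ]; rfl

lemma cgSeq_succ_r (k : ℕ) :
    (cgSeq A b (k + 1)).r = (cgSeq A b k).r - cgAlpha A b k • A (cgSeq A b k).q := by
  rw [cgSeq_succ]; rfl

lemma cgSeq_succ_q (k : ℕ) :
    (cgSeq A b (k + 1)).q = (cgSeq A b (k + 1)).r + cgBeta A b k • (cgSeq A b k).q := by
  unfold cgBeta
  rw [cgSeq_succ]; rfl

/-- The numerator of the coefficient `cgBeta` vanishes with the residual, so termination needs no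
separate treatment. -/
lemma cgSeq_q_eq_zero {k : ℕ} (h : (cgSeq A b k).r = 0) : (cgSeq A b k).q = 0 := by
  cases k with
  | zero => exact h
  | succ k => rw [cgSeq_succ_q, cgBeta, h]; simp

lemma cgBeta_nonneg (k : ℕ) : 0 ≤ cgBeta A b k :=
  div_nonneg real_inner_self_nonneg real_inner_self_nonneg

variable {A}

/-- Exact line search: the step length makes the next residual orthogonal to the current direction,
and this orthogonality carries `⟨q, r⟩ = ‖r‖²` to the next step. Positivity of `A` suffices. -/
lemma cgSeq_inner_q_r (hpos : ∀ u, u ≠ 0 → 0 < (inner ℝ u (A u) : ℝ)) (k : ℕ) :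
    (inner ℝ (cgSeq A b k).q (cgSeq A b k).r : ℝ) =
      inner ℝ (cgSeq A b k).r (cgSeq A b k).r ∧
    cgAlpha A b k * inner ℝ (cgSeq A b k).q (A (cgSeq A b k).q) =
      inner ℝ (cgSeq A b k).r (cgSeq A b k).r ∧
    (inner ℝ (cgSeq A b k).q (cgSeq A b (k + 1)).r : ℝ) = 0 := by
  have aux : ∀ k, (inner ℝ (cgSeq A b k).q (cgSeq A b k).r : ℝ) =
      inner ℝ (cgSeq A b k).r (cgSeq A b k).r →
      cgAlpha A b k * inner ℝ (cgSeq A b k).q (A (cgSeq A b k).q) =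
        inner ℝ (cgSeq A b k).r (cgSeq A b k).r ∧
      (inner ℝ (cgSeq A b k).q (cgSeq A b (k + 1)).r : ℝ) = 0 := by
    intro k h
    have hα : cgAlpha A b k * inner ℝ (cgSeq A b k).q (A (cgSeq A b k).q) =
        inner ℝ (cgSeq A b k).r (cgSeq A b k).r := by
      by_cases hq : (cgSeq A b k).q = 0
      · rw [← h, hq]; simp
      · exact div_mul_cancel₀ _ (hpos _ hq).ne'
    refine ⟨hα, ?_⟩
    rw [cgSeq_succ_r, inner_sub_right, inner_smul_right, hα, h, sub_self]
  have key : (inner ℝ (cgSeq A b k).q (cgSeq A b k).r : ℝ) =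
      inner ℝ (cgSeq A b k).r (cgSeq A b k).r := by
    induction k with
    | zero => rfl
    | succ k ih =>
      rw [cgSeq_succ_q, inner_add_left, inner_smul_left, (aux k ih).2]
      simp
  exact ⟨key, aux k key⟩

lemma cgAlpha_nonneg (hpos : ∀ u, u ≠ 0 → 0 < (inner ℝ u (A u) : ℝ)) (k : ℕ) :
    0 ≤ cgAlpha A b k := by
  refine div_nonneg real_inner_self_nonneg ?_
  by_cases hq : (cgSeq A b k).q = 0
  · rw [hq]; simp
  · exact (hpos _ hq).le

/-- Residuals are orthogonal and directions conjugate along the conjugate gradient method. -/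
lemma cgSeq_orthogonal (hsym : ∀ u v, (inner ℝ (A u) v : ℝ) = inner ℝ u (A v))
    (hpos : ∀ u, u ≠ 0 → 0 < (inner ℝ u (A u) : ℝ)) (k : ℕ) :
    (∀ i < k, (inner ℝ (cgSeq A b i).q (cgSeq A b k).r : ℝ) = 0) ∧
    (∀ i < k, (inner ℝ (cgSeq A b i).r (cgSeq A b k).r : ℝ) = 0) ∧
    (∀ i < k, (inner ℝ (cgSeq A b i).q (A (cgSeq A b k).q) : ℝ) = 0) := by
  induction k with
  | zero => exact ⟨by simp, by simp, by simp⟩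
  | succ k ih =>
    obtain ⟨h1, h2, h3⟩ := ih
    have g1 : ∀ i < k + 1, (inner ℝ (cgSeq A b i).q (cgSeq A b (k + 1)).r : ℝ) = 0 := by
      intro i hi
      rcases Nat.lt_succ_iff_lt_or_eq.mp hi with hi | rfl
      · rw [cgSeq_succ_r, inner_sub_right, inner_smul_right, h1 i hi, h3 i hi]; simp
      · exact (cgSeq_inner_q_r b hpos i).2.2
    have g2 : ∀ i < k + 1, (inner ℝ (cgSeq A b i).r (cgSeq A b (k + 1)).r : ℝ) = 0 := by
      intro i hi
      -- `r₀ = q₀`, and `r_{i+1} = q_{i+1} - β_i q_i`, so orthogonality to the directions passes to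
      -- the residuals.
      cases i with
      | zero => exact g1 0 hi
      | succ i =>
        have e := g1 (i + 1) hi
        rw [cgSeq_succ_q, inner_add_left, inner_smul_left, g1 i (by omega)] at e
        simpa using e
    refine ⟨g1, g2, ?_⟩
    intro i hi
    by_cases hr : (cgSeq A b i).r = 0
    · rw [cgSeq_q_eq_zero A b hr]; simp
    have hr' : (inner ℝ (cgSeq A b i).r (cgSeq A b i).r : ℝ) ≠ 0 := inner_self_ne_zero.mpr hr
    have hα := (cgSeq_inner_q_r b hpos i).2.1
    have hα0 : cgAlpha A b i ≠ 0 := by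
      intro h0
      rw [h0, zero_mul] at hα
      exact hr' hα.symm
    -- `A q_i` is a multiple of `r_i - r_{i+1}`, so conjugacy reduces to orthogonality of residuals;
    -- for `i = k` the surviving `-‖r_{k+1}‖²` is cancelled by the choice of `β_k`.
    have e1 : cgAlpha A b i * inner ℝ (cgSeq A b i).q (A (cgSeq A b (k + 1)).r) =
        inner ℝ (cgSeq A b i).r (cgSeq A b (k + 1)).r -
          inner ℝ (cgSeq A b (i + 1)).r (cgSeq A b (k + 1)).r := by
      rw [← hsym, cgSeq_succ_r A b i, inner_sub_left, inner_smul_left]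
      simp
    apply (mul_eq_zero.mp _).resolve_left hα0
    rw [cgSeq_succ_q A b k, map_add, map_smul, inner_add_right, inner_smul_right, mul_add, e1,
      g2 i hi]
    rcases Nat.lt_succ_iff_lt_or_eq.mp hi with hlt | rfl
    · rw [g2 (i + 1) (by omega), h3 i hlt]; simp
    · rw [mul_left_comm, hα, cgBeta, div_mul_cancel₀ _ hr']; ring

/-- A conjugate gradient iterate is `0` or makes a definite angle with the right-hand side. -/
lemma cgIterate_inner (hsym : ∀ u v, (inner ℝ (A u) v : ℝ) = inner ℝ u (A v))
    (hpos : ∀ u, u ≠ 0 → 0 < (inner ℝ u (A u) : ℝ)) {M : ℝ} (hM : 0 < M)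
    (hA : ∀ u, ‖A u‖ ≤ M * ‖u‖) (i : ℕ) :
    cgIterate A b i = 0 ∨ ‖b‖ ^ 2 / M ≤ inner ℝ b (cgIterate A b i) := by
  -- Since `b = r₀` is orthogonal to every later residual and `β ≥ 0`, `⟨b, q_k⟩` stays nonnegative.
  -- Thus `⟨b, x_i⟩` is nondecreasing in `i`, and the first step already reaches the bound.
  have hq : ∀ k, (0 : ℝ) ≤ inner ℝ b (cgSeq A b k).q := by
    intro k
    induction k with
    | zero => exact real_inner_self_nonneg
    | succ k ih =>
      have := (cgSeq_orthogonal b hsym hpos (k + 1)).2.1 0 (Nat.succ_pos k)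
      have h0 : (cgSeq A b 0).r = b := rfl
      rw [h0] at this
      rw [cgSeq_succ_q, inner_add_right, this, inner_smul_right, zero_add]
      exact mul_nonneg (cgBeta_nonneg A b k) ih
  cases i with
  | zero => exact Or.inl rfl
  | succ i =>
    right
    change _ ≤ inner ℝ b (cgSeq A b (i + 1)).x
    induction i with
    | zero =>
      have hx : (cgSeq A b 0).x = 0 := rfl
      have hqb : (cgSeq A b 0).q = b := rfl
      have hrb : (cgSeq A b 0).r = b := rfl
      rw [cgSeq_succ_x, hx, zero_add, inner_smul_right, cgAlpha, hqb, hrb,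
        real_inner_self_eq_norm_sq]
      by_cases hb : b = 0
      · simp [hb]
      have hb' : 0 < ‖b‖ ^ 2 := by positivity
      have h1 : (inner ℝ b (A b) : ℝ) ≤ M * ‖b‖ ^ 2 := by
        calc (inner ℝ b (A b) : ℝ) ≤ ‖b‖ * ‖A b‖ := real_inner_le_norm _ _
          _ ≤ ‖b‖ * (M * ‖b‖) := by gcongr; exact hA b
          _ = _ := by ring
      rw [div_mul_eq_mul_div, div_le_div_iff₀ hM (hpos b hb)]
      nlinarith
    | succ i ih =>
      rw [cgSeq_succ_x, inner_add_right, inner_smul_right]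
      have := mul_nonneg (cgAlpha_nonneg b hpos (i + 1)) (hq (i + 1))
      linarith

end CG

/-! ### Abstract Newton method: line search, global convergence, local rate -/

/-- Along short segments issuing from `x`, the map `F` is affine up to an error which is
quadratic in the length of the segment and vanishes at the far end. -/
def SegmentAffineAt {E F : Type*} [NormedAddCommGroup E] [NormedSpace ℝ E]
    [NormedAddCommGroup F] [NormedSpace ℝ F] (f : E → F) (x : E) : Prop :=
  ∃ C : ℝ, 0 ≤ C ∧ ∀ᶠ e in 𝓝 (0 : E), ∀ t ∈ Set.Icc (0 : ℝ) 1,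
    ‖f (x + t • e) - ((1 - t) • f x + t • f (x + e))‖ ≤ C * (1 - t) * ‖e‖ ^ 2

section Abstract

variable {E : Type*} [NormedAddCommGroup E] [InnerProductSpace ℝ E]
variable {f : E → ℝ} {g : E → E} {m M : ℝ}

lemma strongConvex_inner (hconv : ∀ w v, f w + inner ℝ (g w) (v - w) + m / 2 * ‖v - w‖ ^ 2 ≤ f v)
    {x : E} (hx : g x = 0) (w : E) : m * ‖w - x‖ ^ 2 ≤ inner ℝ (g w) (w - x) := by
  have h1 := hconv w x
  have h2 := hconv x w
  rw [hx, inner_zero_left] at h2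
  rw [← neg_sub w x, inner_neg_right, norm_neg] at h1
  linarith

/-- Convexity at the new point gives `f (w + d) ≤ f w + ⟨g (w + d), d⟩`; moving the gradient back to
`w` costs `M‖d‖²`. The constant is `M` rather than `M/2` because nothing is integrated. -/
lemma quadratic_upper_bound (hm : 0 ≤ m)
    (hconv : ∀ w v, f w + inner ℝ (g w) (v - w) + m / 2 * ‖v - w‖ ^ 2 ≤ f v)
    (hlip : ∀ w v, ‖g w - g v‖ ≤ M * ‖w - v‖) (w d : E) :
    f (w + d) ≤ f w + inner ℝ (g w) d + M * ‖d‖ ^ 2 := by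
  have h1 := hconv (w + d) w
  have h2 := hlip (w + d) w
  have e1 : w - (w + d) = -d := by abel
  have e2 : w + d - w = d := by abel
  rw [e1, inner_neg_right, norm_neg] at h1
  rw [e2] at h2
  have h3 : inner ℝ (g (w + d) - g w) d ≤ ‖g (w + d) - g w‖ * ‖d‖ := real_inner_le_norm _ _
  rw [inner_sub_left] at h3
  have h4 : ‖g (w + d) - g w‖ * ‖d‖ ≤ M * ‖d‖ * ‖d‖ := by gcongr
  have h5 : 0 ≤ m / 2 * ‖d‖ ^ 2 := by positivity
  nlinarith

/-- The gap of a strongly convex function is controlled by its gradient. -/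
lemma gap_le_norm_gradient_sq (hm : 0 < m)
    (hconv : ∀ w v, f w + inner ℝ (g w) (v - w) + m / 2 * ‖v - w‖ ^ 2 ≤ f v) (x w : E) :
    2 * m * (f w - f x) ≤ ‖g w‖ ^ 2 := by
  have h1 := hconv w x
  have h2 : -inner ℝ (g w) (x - w) ≤ ‖g w‖ * ‖x - w‖ := by
    rw [← inner_neg_right, ← norm_neg (x - w)]
    exact real_inner_le_norm _ _
  nlinarith [sq_nonneg (‖g w‖ - m * ‖x - w‖)]

/-- By `gap_le_norm_gradient_sq` the decrease is at least `2mκ` times the gap, so the gap decays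
geometrically; strong convexity turns this into convergence of the points. -/
lemma tendsto_of_gap_contraction {x : E} {κ : ℝ} {w : ℕ → E} (hm : 0 < m) (hκ : 0 < κ)
    (hconv : ∀ w v, f w + inner ℝ (g w) (v - w) + m / 2 * ‖v - w‖ ^ 2 ≤ f v)
    (hx : g x = 0) (hdec : ∀ j, f (w (j + 1)) ≤ f (w j) - κ * ‖g (w j)‖ ^ 2) :
    Tendsto w atTop (𝓝 x) := by
  have hgap : ∀ v, m / 2 * ‖v - x‖ ^ 2 ≤ f v - f x := by
    intro v
    have := hconv x v
    rw [hx, inner_zero_left] at this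
    linarith
  have hgap0 : ∀ v, 0 ≤ f v - f x := fun v => le_trans (by positivity) (hgap v)
  -- The maximum keeps the ratio nonnegative without a proof that `2mκ ≤ 1`.
  set ρ := max 0 (1 - κ * (2 * m)) with hρ
  have hρ1 : ρ < 1 := max_lt one_pos (by nlinarith)
  have hstep : ∀ j, f (w j) - f x ≤ ρ ^ j * (f (w 0) - f x) := by
    intro j
    induction j with
    | zero => simp
    | succ j ih =>
      have h1 := gap_le_norm_gradient_sq hm hconv x (w j)
      have h2 := mul_le_mul_of_nonneg_left h1 hκ.le
      calc f (w (j + 1)) - f x ≤ (1 - κ * (2 * m)) * (f (w j) - f x) := by linarith [hdec j]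
        _ ≤ ρ * (f (w j) - f x) := mul_le_mul_of_nonneg_right (le_max_right _ _) (hgap0 _)
        _ ≤ ρ * (ρ ^ j * (f (w 0) - f x)) := mul_le_mul_of_nonneg_left ih (le_max_left _ _)
        _ = _ := by ring
  have hlim : Tendsto (fun j => 2 / m * (ρ ^ j * (f (w 0) - f x))) atTop (𝓝 0) := by
    have := ((tendsto_pow_atTop_nhds_zero_of_lt_one (le_max_left _ _) hρ1).mul_const
      (f (w 0) - f x)).const_mul (2 / m)
    simpa using this
  have hsq : Tendsto (fun j => ‖w j - x‖ ^ 2) atTop (𝓝 0) := by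
    refine squeeze_zero (fun _ => by positivity) (fun j => ?_) hlim
    have := (hgap (w j)).trans (hstep j)
    rw [div_mul_eq_mul_div, le_div_iff₀ hm]
    linarith
  rw [tendsto_iff_norm_sub_tendsto_zero]
  have := hsq.sqrt
  simpa [Real.sqrt_sq] using this

/-- The Armijo step length is bounded below along descent directions. -/
lemma armijo_decrease {μ δ c B : ℝ} {w d : E} {k : ℕ} (hm : 0 < m) (hM : 0 < M) (hc : 0 < c)
    (hB : 0 < B) (hμ : μ ∈ Set.Ioo (0 : ℝ) 1) (hδ : δ ∈ Set.Ioo (0 : ℝ) 1)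
    (hconv : ∀ w v, f w + inner ℝ (g w) (v - w) + m / 2 * ‖v - w‖ ^ 2 ≤ f v)
    (hlip : ∀ w v, ‖g w - g v‖ ≤ M * ‖w - v‖)
    (hdesc : c * ‖g w‖ ^ 2 ≤ -inner ℝ (g w) d) (hd : ‖d‖ ≤ B * ‖g w‖)
    (hk : IsLeast {k : ℕ | f (w + δ ^ k • d) ≤ f w + μ * δ ^ k * inner ℝ (g w) d} k) :
    f (w + δ ^ k • d) ≤
      f w - μ * min 1 (δ * ((1 - μ) * c / (M * B ^ 2))) * c * ‖g w‖ ^ 2 := by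
  have hk1 : f (w + δ ^ k • d) ≤ f w + μ * δ ^ k * inner ℝ (g w) d := hk.1
  rcases (norm_nonneg (g w)).eq_or_lt with h0 | h0
  · have hd0 : ‖d‖ ≤ 0 := by rw [← h0] at hd; simpa using hd
    have : d = 0 := norm_le_zero_iff.mp hd0
    rw [this, ← h0]; simp
  suffices hs : min 1 (δ * ((1 - μ) * c / (M * B ^ 2))) ≤ δ ^ k by
    have h1 : min 1 (δ * ((1 - μ) * c / (M * B ^ 2))) * (c * ‖g w‖ ^ 2) ≤
        δ ^ k * -inner ℝ (g w) d := by
      have : 0 ≤ δ ^ k := pow_nonneg hδ.1.le k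
      gcongr
    have h2 := mul_le_mul_of_nonneg_left h1 hμ.1.le
    linarith
  -- For a positive exponent the preceding power fails the Armijo test. Against the quadratic upper
  -- bound, that failure forces this power to be at least `(1 - μ)c/(MB²)`; the accepted step is `δ`
  -- times it.
  cases k with
  | zero => simp
  | succ k =>
    refine (min_le_right _ _).trans ?_
    rw [pow_succ' δ k, mul_le_mul_iff_right₀ hδ.1]
    have hnot : ¬ f (w + δ ^ k • d) ≤ f w + μ * δ ^ k * inner ℝ (g w) d := fun h =>
      absurd (hk.2 h) (by omega)
    push Not at hnot
    have hα : 0 < δ ^ k := pow_pos hδ.1 k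
    have hup := quadratic_upper_bound hm.le hconv hlip w (δ ^ k • d)
    rw [inner_smul_right, norm_smul, Real.norm_of_nonneg hα.le] at hup
    set α := δ ^ k
    have h3 : α * ((1 - μ) * -inner ℝ (g w) d) < α * (M * α * ‖d‖ ^ 2) := by nlinarith
    have h4 : (1 - μ) * -inner ℝ (g w) d < M * α * ‖d‖ ^ 2 := lt_of_mul_lt_mul_left h3 hα.le
    have h5 : (1 - μ) * (c * ‖g w‖ ^ 2) ≤ (1 - μ) * -inner ℝ (g w) d :=
      mul_le_mul_of_nonneg_left hdesc (by linarith [hμ.2])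
    have h6 : M * α * ‖d‖ ^ 2 ≤ M * α * (B * ‖g w‖) ^ 2 := by gcongr
    rw [div_le_iff₀ (by positivity)]
    have h7 : 0 < ‖g w‖ ^ 2 := by positivity
    refine le_of_mul_le_mul_right ?_ h7
    nlinarith

variable [CompleteSpace E]

/-- A second order expansion from below at a minimizer. -/
lemma half_inner_le_gap (hgrad : ∀ w, HasGradientAt f (g w) w) {x : E} (hx : g x = 0)
    (hS : SegmentAffineAt g x) :
    ∃ C : ℝ, ∀ᶠ w in 𝓝 x,
      1 / 2 * inner ℝ (g w) (w - x) - C * ‖w - x‖ ^ 3 ≤ f w - f x := by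
  obtain ⟨C, hC, hev⟩ := hS
  refine ⟨C, ?_⟩
  have ht : Tendsto (fun w => w - x) (𝓝 x) (𝓝 0) := by
    have : Tendsto (fun w => w - x) (𝓝 x) (𝓝 (x - x)) :=
      (continuous_id.sub continuous_const).tendsto x
    simpa using this
  filter_upwards [ht.eventually hev] with w hw
  set e := w - x with he
  have hxe : x + e = w := by simp [he]
  let a : ℝ := inner ℝ (g w) e
  -- If `g` were affine on the segment, `f` along it would have derivative `t * a`; subtracting `t²
  -- / 2 * a` leaves a function with derivative `O(‖e‖³)`.
  have hder : ∀ t ∈ Set.Icc (0 : ℝ) 1, HasDerivWithinAt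
      (fun t : ℝ => f (x + t • e) - t ^ 2 / 2 * a)
      (inner ℝ (g (x + t • e)) e - t * a) (Set.Icc 0 1) t := by
    intro t _
    have hl : HasDerivAt (fun t : ℝ => x + t • e) e t := by
      simpa using ((hasDerivAt_id t).smul_const e).const_add x
    have h1 := (hgrad (x + t • e)).hasFDerivAt.comp_hasDerivAt t hl
    have h2 : HasDerivAt (fun t : ℝ => t ^ 2 / 2 * a) (t * a) t := by
      refine (((hasDerivAt_pow 2 t).div_const 2).mul_const a).congr_deriv ?_
      norm_num
    exact ((h1.sub h2).hasDerivWithinAt (s := Set.Icc 0 1)).congr_deriv (by simp)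
  have hb : ∀ t ∈ Set.Ico (0 : ℝ) 1, ‖(inner ℝ (g (x + t • e)) e - t * a : ℝ)‖ ≤
      C * ‖e‖ ^ 3 := by
    intro t ht
    have h1 := hw t ⟨ht.1, ht.2.le⟩
    rw [hx, smul_zero, zero_add, hxe] at h1
    have h2 : (inner ℝ (g (x + t • e)) e - t * a : ℝ) =
        inner ℝ (g (x + t • e) - t • g w) e := by
      rw [inner_sub_left, inner_smul_left]; rfl
    rw [h2]
    calc ‖(inner ℝ (g (x + t • e) - t • g w) e : ℝ)‖
        ≤ ‖g (x + t • e) - t • g w‖ * ‖e‖ := norm_inner_le_norm _ _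
      _ ≤ (C * (1 - t) * ‖e‖ ^ 2) * ‖e‖ := by gcongr
      _ ≤ (C * 1 * ‖e‖ ^ 2) * ‖e‖ := by
          gcongr
          linarith [ht.1]
      _ = _ := by ring
  have := norm_image_sub_le_of_norm_deriv_le_segment_01' hder hb
  simp only [one_smul, zero_smul, add_zero, hxe, Real.norm_eq_abs] at this
  have h4 := (abs_le.mp this).1
  simp only [a] at h4
  linarith

/-- Local behaviour of inexact Newton steps: superlinear decrease and acceptance of the unit
step. -/
lemma newton_local {x : E} {μ θ C₁ : ℝ} {Hess : E → Set (E →L[ℝ] E)}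
    (hm : 0 < m) (hM : 0 < M) (hμ : μ ∈ Set.Ioo (0 : ℝ) (1 / 2)) (hθ : θ ∈ Set.Ioc (0 : ℝ) 1)
    (hgrad : ∀ w, HasGradientAt f (g w) w)
    (hconv : ∀ w v, f w + inner ℝ (g w) (v - w) + m / 2 * ‖v - w‖ ^ 2 ≤ f v)
    (hlip : ∀ w v, ‖g w - g v‖ ≤ M * ‖w - v‖)
    (hH : ∀ w, ∀ H ∈ Hess w, ∀ u, m * ‖u‖ ^ 2 ≤ inner ℝ (H u) u)
    (hx : g x = 0) (hS : SegmentAffineAt g x)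
    (hss : ∀ᶠ w in 𝓝 x, ∀ H ∈ Hess w, ‖g w - g x - H (w - x)‖ ≤ C₁ * ‖w - x‖ ^ 2) :
    ∃ K : ℝ, ∀ᶠ w in 𝓝 x, ∀ H ∈ Hess w, ∀ d, ‖H d + g w‖ ≤ ‖g w‖ ^ (1 + θ) →
      ‖w + d - x‖ ≤ K * ‖w - x‖ ^ (1 + θ) ∧ f (w + d) ≤ f w + μ * inner ℝ (g w) d := by
  obtain ⟨C₂, hC₂⟩ := half_inner_le_gap hgrad hx hS
  -- With `z = w + d - x`, `H z` is the linear system residual minus the semismoothness error: these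
  -- contribute `M ^ (1 + θ)` and `|C₁|`, and coercivity of `H` contributes `1 / m`.
  set K : ℝ := 1 / m * (M ^ (1 + θ) + |C₁|) with hK
  have hK0 : 0 ≤ K := by positivity
  refine ⟨K, ?_⟩
  have hn : Tendsto (fun w => ‖w - x‖) (𝓝 x) (𝓝 0) := by
    have : Tendsto (fun w => ‖w - x‖) (𝓝 x) (𝓝 ‖x - x‖) :=
      (continuous_id.sub continuous_const).norm.tendsto x
    simpa using this
  have hnθ : Tendsto (fun w => ‖w - x‖ ^ θ) (𝓝 x) (𝓝 0) := by
    have := hn.rpow_const (p := θ) (Or.inr hθ.1.le)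
    rwa [Real.zero_rpow hθ.1.ne'] at this
  -- The relative errors in the Armijo test for the unit step: the cubic remainder of the gap, the
  -- replacement of `d` by `-(w - x)` in `⟨g w, d⟩`, and the value left at `w + d`.
  have hsmall : Tendsto (fun w => C₂ * ‖w - x‖ + μ * M * (K * ‖w - x‖ ^ θ) +
      M * (K * ‖w - x‖ ^ θ) ^ 2) (𝓝 x) (𝓝 0) := by
    have := ((hn.const_mul C₂).add ((hnθ.const_mul K).const_mul (μ * M))).add
      (((hnθ.const_mul K).pow 2).const_mul M)
    simpa using this
  have hc : 0 < (1 / 2 - μ) * m := mul_pos (by linarith [hμ.2]) hm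
  filter_upwards [hss, hC₂, hsmall.eventually_le_const hc, hn.eventually_le_const one_pos]
    with w hw1 hw2 hw3 hw4 H hHw d hd
  set e := w - x with he
  have hθ1 : 0 < 1 + θ := by linarith [hθ.1]
  have hgw : ‖g w‖ ≤ M * ‖e‖ := by
    have := hlip w x
    rwa [hx, sub_zero] at this
  have hrate : ‖w + d - x‖ ≤ K * ‖e‖ ^ (1 + θ) := by
    set z := w + d - x with hz
    have hzed : z = d + e := by rw [hz, he]; abel
    have h1 : m * ‖z‖ ≤ ‖H z‖ := by
      have h2 := (hH w H hHw z).trans (real_inner_le_norm _ _)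
      by_cases hz0 : ‖z‖ = 0
      · rw [hz0]; simp
      · have : 0 < ‖z‖ := lt_of_le_of_ne (norm_nonneg _) (Ne.symm hz0)
        nlinarith
    have h2 : ‖H z‖ ≤ ‖H d + g w‖ + ‖g w - g x - H e‖ := by
      have : H z = (H d + g w) - (g w - g x - H e) := by
        rw [hzed, map_add, hx]; abel
      rw [this]
      exact norm_sub_le _ _
    have h3 : ‖g w‖ ^ (1 + θ) ≤ M ^ (1 + θ) * ‖e‖ ^ (1 + θ) := by
      rw [← Real.mul_rpow hM.le (norm_nonneg _)]
      exact Real.rpow_le_rpow (norm_nonneg _) hgw hθ1.le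
    have h4 : ‖g w - g x - H e‖ ≤ |C₁| * ‖e‖ ^ (1 + θ) := by
      refine (hw1 H hHw).trans ?_
      have : ‖e‖ ^ 2 ≤ ‖e‖ ^ (1 + θ) := by
        rcases (norm_nonneg e).eq_or_lt with h0 | h0
        · rw [← h0, Real.zero_rpow hθ1.ne']; simp
        · rw [← Real.rpow_natCast]
          exact Real.rpow_le_rpow_of_exponent_ge h0 hw4 (by norm_num; linarith [hθ.2])
      calc C₁ * ‖e‖ ^ 2 ≤ |C₁| * ‖e‖ ^ 2 := by gcongr; exact le_abs_self _
        _ ≤ _ := by gcongr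
    rw [hK, mul_assoc, one_div, inv_mul_eq_div, le_div_iff₀ hm]
    linarith
  refine ⟨hrate, ?_⟩
  have hrate' : ‖w + d - x‖ ≤ K * ‖e‖ ^ θ * ‖e‖ := by
    refine hrate.trans_eq ?_
    rw [Real.rpow_add' (norm_nonneg _) hθ1.ne', Real.rpow_one]; ring
  have hup := quadratic_upper_bound hm.le hconv hlip x (w + d - x)
  rw [hx, inner_zero_left, add_zero, add_sub_cancel] at hup
  have hstr := strongConvex_inner hconv hx w
  rw [← he] at hstr
  have hid : (inner ℝ (g w) d : ℝ) = inner ℝ (g w) (w + d - x) - inner ℝ (g w) e := by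
    rw [← inner_sub_right]; congr 1; rw [he]; abel
  have hcs : -(inner ℝ (g w) (w + d - x) : ℝ) ≤ M * ‖e‖ * ‖w + d - x‖ := by
    rw [← inner_neg_right, ← norm_neg (w + d - x)]
    exact (real_inner_le_norm _ _).trans (by gcongr)
  set ρ := K * ‖e‖ ^ θ with hρ
  have hρ0 : 0 ≤ ρ := by positivity
  have h5 : M * ‖w + d - x‖ ^ 2 ≤ M * (ρ * ‖e‖) ^ 2 := by gcongr
  have h6 : M * ‖e‖ * ‖w + d - x‖ ≤ M * ‖e‖ * (ρ * ‖e‖) := by gcongr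
  have h7 : (C₂ * ‖e‖ + μ * M * ρ + M * ρ ^ 2) * ‖e‖ ^ 2 ≤ (1 / 2 - μ) * m * ‖e‖ ^ 2 := by
    gcongr
  have h8 : (1 / 2 - μ) * (m * ‖e‖ ^ 2) ≤ (1 / 2 - μ) * inner ℝ (g w) e :=
    mul_le_mul_of_nonneg_left hstr (by linarith [hμ.2])
  have h9 : μ * -(inner ℝ (g w) (w + d - x) : ℝ) ≤ μ * (M * ‖e‖ * (ρ * ‖e‖)) :=
    mul_le_mul_of_nonneg_left (hcs.trans h6) hμ.1.le
  rw [hid]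
  -- The full step gains about `½⟨g w, e⟩` while the test demands about `μ⟨g w, e⟩`; the margin is
  -- at least `(1/2 - μ) m ‖e‖²`, which absorbs the errors by `h7`.
  nlinarith

end Abstract

/-- The direction of an inexact Newton step is a descent direction of controlled length. -/
lemma IsNewtonDirection.descent {n : ℕ} {H : Vec n →L[ℝ] Vec n} {v d : Vec n} {η θ m M : ℝ}
    (hm : 0 < m) (hM : 0 < M) (hη : η < 1) (hθ : 0 < θ)
    (hsym : ∀ u v, (inner ℝ (H u) v : ℝ) = inner ℝ u (H v))
    (hpos : ∀ u, m * ‖u‖ ^ 2 ≤ inner ℝ (H u) u) (hbd : ∀ u, ‖H u‖ ≤ M * ‖u‖)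
    (hd : IsNewtonDirection H v η θ d) :
    min (m / M ^ 2) (1 / M) * ‖v‖ ^ 2 ≤ -inner ℝ v d ∧ ‖d‖ ≤ 2 / m * ‖v‖ := by
  obtain ⟨h1, h2⟩ := hd
  have hr1 : ‖H d + v‖ ≤ η := h2.trans (min_le_left _ _)
  have hr2 : ‖H d + v‖ ≤ ‖v‖ ^ (1 + θ) := h2.trans (min_le_right _ _)
  have hθ1 : 0 < 1 + θ := by linarith
  have hpow : ‖v‖ ≤ 1 → ‖v‖ ^ (1 + θ) ≤ ‖v‖ := by
    intro hv
    rcases (norm_nonneg v).eq_or_lt with h0 | h0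
    · rw [← h0, Real.zero_rpow hθ1.ne']
    · calc ‖v‖ ^ (1 + θ) ≤ ‖v‖ ^ (1 : ℝ) :=
            Real.rpow_le_rpow_of_exponent_ge h0 hv (by linarith)
        _ = ‖v‖ := Real.rpow_one _
  -- For `‖v‖ ≤ 1` the power bound applies, otherwise `η < 1 ≤ ‖v‖`; this yields the factor `2` in
  -- `2 / m`.
  have hrv : ‖H d + v‖ ≤ ‖v‖ := by
    rcases le_total ‖v‖ 1 with hv | hv
    · exact hr2.trans (hpow hv)
    · linarith
  constructor
  · rcases h1 with h1 | ⟨i, rfl⟩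
    · have hv : v = -H d := by rw [h1, neg_neg]
      have h3 : ‖v‖ ≤ M * ‖d‖ := by rw [hv, norm_neg]; exact hbd d
      have h4 : m * ‖d‖ ^ 2 ≤ -inner ℝ v d := by
        rw [hv, inner_neg_left, neg_neg]; exact hpos d
      calc min (m / M ^ 2) (1 / M) * ‖v‖ ^ 2 ≤ m / M ^ 2 * ‖v‖ ^ 2 := by
            gcongr; exact min_le_left _ _
        _ ≤ m / M ^ 2 * (M * ‖d‖) ^ 2 := by gcongr
        _ = m * ‖d‖ ^ 2 := by field_simp
        _ ≤ _ := h4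
    · have hpos' : ∀ u, u ≠ 0 → 0 < (inner ℝ u (H u) : ℝ) := by
        intro u hu
        rw [← hsym]
        exact lt_of_lt_of_le (by positivity) (hpos u)
      rcases cgIterate_inner (-v) hsym hpos' hM hbd i with h3 | h3
      -- The zero iterate passes the residual test only for `v = 0`, since `‖v‖ ≤ η < 1` and `‖v‖ ≤
      -- ‖v‖ ^ (1 + θ)`.
      · rw [h3, map_zero, zero_add] at hr1 hr2
        have hv0 : v = 0 := by
          by_contra hv
          have hv : 0 < ‖v‖ := norm_pos_iff.mpr hv
          have := Real.rpow_lt_rpow_of_exponent_gt hv (by linarith : ‖v‖ < 1)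
            (by linarith : (1 : ℝ) < 1 + θ)
          rw [Real.rpow_one] at this
          linarith
        rw [hv0]; simp
      · rw [norm_neg, inner_neg_left] at h3
        refine le_trans ?_ h3
        calc min (m / M ^ 2) (1 / M) * ‖v‖ ^ 2 ≤ 1 / M * ‖v‖ ^ 2 := by
              gcongr; exact min_le_right _ _
          _ = _ := by ring
  · have h3 : m * ‖d‖ ≤ ‖H d‖ := by
      have h4 := (hpos d).trans (real_inner_le_norm _ _)
      by_cases hd0 : ‖d‖ = 0
      · rw [hd0]; simp
      · have : 0 < ‖d‖ := lt_of_le_of_ne (norm_nonneg _) (Ne.symm hd0)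
        nlinarith
    have h4 : ‖H d‖ ≤ ‖H d + v‖ + ‖v‖ := by
      have : H d = (H d + v) - v := by abel
      calc ‖H d‖ = ‖(H d + v) - v‖ := by rw [← this]
        _ ≤ _ := norm_sub_le _ _
    rw [div_mul_eq_mul_div, le_div_iff₀ hm]
    linarith

lemma exists_gradient_eq_zero {n : ℕ} {f : Vec n → ℝ} {g : Vec n → Vec n} {m : ℝ} (hm : 0 < m)
    (hgrad : ∀ w, HasGradientAt f (g w) w)
    (hconv : ∀ w v, f w + inner ℝ (g w) (v - w) + m / 2 * ‖v - w‖ ^ 2 ≤ f v) :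
    ∃ x, g x = 0 := by
  have hcont : Continuous f := continuous_iff_continuousAt.mpr fun w =>
    (hgrad w).differentiableAt.continuousAt
  have hco : Tendsto f (cocompact (Vec n)) atTop := by
    have h1 : Tendsto (fun v : Vec n => ‖v‖ * (m / 2 * ‖v‖ + -‖g 0‖) + f 0)
        (cocompact (Vec n)) atTop := by
      refine tendsto_atTop_add_const_right _ _ ?_
      refine Tendsto.atTop_mul_atTop₀ (tendsto_norm_cocompact_atTop) ?_
      refine tendsto_atTop_add_const_right _ _ ?_
      exact (tendsto_norm_cocompact_atTop).const_mul_atTop (by positivity)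
    refine tendsto_atTop_mono (fun v => ?_) h1
    have h2 := hconv 0 v
    rw [sub_zero] at h2
    have h3 : -(inner ℝ (g 0) v : ℝ) ≤ ‖g 0‖ * ‖v‖ := by
      rw [← inner_neg_right, ← norm_neg v]
      exact real_inner_le_norm _ _
    nlinarith
  obtain ⟨x, hx⟩ := hcont.exists_forall_le hco
  refine ⟨x, ?_⟩
  have hmin : IsLocalMin f x := Filter.Eventually.of_forall hx
  have := hmin.hasFDerivAt_eq_zero (hgrad x).hasFDerivAt
  simpa using this

/-- Global convergence and local superlinear convergence of the inexact Newton method with Armijo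
line search for a strongly convex function whose gradient is strongly semismooth. -/
theorem newton_convergence {n : ℕ} {f : Vec n → ℝ} {g : Vec n → Vec n} {m M μ η θ δ : ℝ}
    {Hess : Vec n → Set (Vec n →L[ℝ] Vec n)} {w : ℕ → Vec n} (hm : 0 < m) (hM : 0 < M)
    (hμ : μ ∈ Set.Ioo (0 : ℝ) (1 / 2)) (hη : η < 1)
    (hθ : θ ∈ Set.Ioc (0 : ℝ) 1) (hδ : δ ∈ Set.Ioo (0 : ℝ) 1)
    (hgrad : ∀ w, HasGradientAt f (g w) w)
    (hconv : ∀ w v, f w + inner ℝ (g w) (v - w) + m / 2 * ‖v - w‖ ^ 2 ≤ f v)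
    (hlip : ∀ w v, ‖g w - g v‖ ≤ M * ‖w - v‖)
    (hsym : ∀ w, ∀ H ∈ Hess w, ∀ u v, (inner ℝ (H u) v : ℝ) = inner ℝ u (H v))
    (hpos : ∀ w, ∀ H ∈ Hess w, ∀ u, m * ‖u‖ ^ 2 ≤ inner ℝ (H u) u)
    (hbd : ∀ w, ∀ H ∈ Hess w, ∀ u, ‖H u‖ ≤ M * ‖u‖)
    (hS : ∀ x, SegmentAffineAt g x)
    (hss : ∀ x, ∃ C : ℝ, ∀ᶠ w in 𝓝 x, ∀ H ∈ Hess w,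
      ‖g w - g x - H (w - x)‖ ≤ C * ‖w - x‖ ^ 2)
    (hw : ∀ j, ∃ H ∈ Hess (w j), ∃ d : Vec n, ∃ k : ℕ,
      IsNewtonDirection H (gradient f (w j)) η θ d ∧ IsArmijoExponent f (w j) d μ δ k ∧
      w (j + 1) = w j + δ ^ k • d) :
    ∃ x : Vec n, (∀ v, IsMinOn f Set.univ v ↔ v = x) ∧ Tendsto w atTop (𝓝 x) ∧
      (fun j => ‖w (j + 1) - x‖) =O[atTop] (fun j => ‖w j - x‖ ^ (1 + θ)) := by
  obtain ⟨x, hx⟩ := exists_gradient_eq_zero hm hgrad hconv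
  have hgap : ∀ v, m / 2 * ‖v - x‖ ^ 2 ≤ f v - f x := by
    intro v
    have := hconv x v
    rw [hx, inner_zero_left] at this
    linarith
  have hconvg : Tendsto w atTop (𝓝 x) := by
    have hμ1 : 0 < 1 - μ := by linarith [hμ.2]
    have hδ0 := hδ.1
    have hμ0 := hμ.1
    have hc : 0 < min (m / M ^ 2) (1 / M) := lt_min (by positivity) (by positivity)
    -- The decrease constant of `armijo_decrease` with `c = min (m / M²) (1 / M)` and `B = 2 / m`.
    refine tendsto_of_gap_contraction (κ := μ * min 1 (δ * ((1 - μ) *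
      min (m / M ^ 2) (1 / M) / (M * (2 / m) ^ 2))) * min (m / M ^ 2) (1 / M)) hm ?_ hconv hx ?_
    · have : 0 < min 1 (δ * ((1 - μ) * min (m / M ^ 2) (1 / M) / (M * (2 / m) ^ 2))) :=
        lt_min one_pos (by positivity)
      positivity
    · intro j
      obtain ⟨H, hH, d, k, h1, h2, h3⟩ := hw j
      rw [IsArmijoExponent] at h2
      rw [(hgrad (w j)).gradient] at h1 h2
      obtain ⟨h4, h5⟩ := h1.descent hm hM hη hθ.1 (hsym _ H hH) (hpos _ H hH) (hbd _ H hH)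
      rw [h3]
      exact armijo_decrease hm hM hc (by positivity) ⟨hμ.1, by linarith [hμ.2]⟩ hδ hconv hlip
        h4 h5 h2
  refine ⟨x, fun v => ⟨fun hv => ?_, ?_⟩, hconvg, ?_⟩
  · have h1 : f v ≤ f x := hv (Set.mem_univ x)
    have h2 := hgap v
    have h3 : ‖v - x‖ ^ 2 ≤ 0 := by nlinarith
    have h4 : ‖v - x‖ = 0 := pow_eq_zero_iff (two_ne_zero) |>.mp (le_antisymm h3 (by positivity))
    exact sub_eq_zero.mp (norm_eq_zero.mp h4)
  · rintro rfl
    intro u _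
    have : 0 ≤ m / 2 * ‖u - v‖ ^ 2 := by positivity
    have := hgap u
    simp only [Set.mem_ofPred_eq]
    linarith
  · obtain ⟨C, hC⟩ := hss x
    obtain ⟨K, hK⟩ := newton_local hm hM hμ hθ hgrad hconv hlip hpos hx (hS x) hC
    refine Asymptotics.IsBigO.of_bound K ?_
    filter_upwards [hconvg.eventually hK] with j hj
    obtain ⟨H, hH, d, k, h1, h2, h3⟩ := hw j
    rw [IsArmijoExponent] at h2
    rw [(hgrad (w j)).gradient] at h1 h2
    obtain ⟨h4, h5⟩ := hj H hH d (h1.2.trans (min_le_right _ _))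
    have hk : k = 0 := by
      refine Nat.le_zero.mp (h2.2 ?_)
      simpa using h5
    rw [h3, hk, pow_zero, one_smul, norm_norm,
      Real.norm_of_nonneg (Real.rpow_nonneg (norm_nonneg _) _)]
    exact h4

/-! ### Calculus of `SegmentAffineAt` and its consequence for Clarke Jacobians -/

namespace SegmentAffineAt

variable {E F G : Type*} [NormedAddCommGroup E] [NormedSpace ℝ E]
  [NormedAddCommGroup F] [NormedSpace ℝ F] [NormedAddCommGroup G] [NormedSpace ℝ G]

lemma congr {f₁ f₂ : E → F} {x : E} (h : SegmentAffineAt f₁ x) (hf : f₁ =ᶠ[𝓝 x] f₂) :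
    SegmentAffineAt f₂ x := by
  obtain ⟨C, hC, h⟩ := h
  refine ⟨C, hC, ?_⟩
  obtain ⟨r, hr, hball⟩ := Metric.eventually_nhds_iff_ball.mp hf
  filter_upwards [h, Metric.ball_mem_nhds 0 hr] with e he her t ht
  rw [mem_ball_zero_iff] at her
  have h1 : f₁ (x + t • e) = f₂ (x + t • e) := by
    apply hball
    rw [mem_ball_iff_norm, add_sub_cancel_left, norm_smul, Real.norm_of_nonneg ht.1]
    nlinarith [ht.2, norm_nonneg e]
  have h2 : f₁ (x + e) = f₂ (x + e) := by
    apply hball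
    rwa [mem_ball_iff_norm, add_sub_cancel_left]
  rw [← h1, ← h2, ← hf.self_of_nhds]
  exact he t ht

lemma of_eventually_eq {f : E → F} {x : E} (h : ∀ᶠ e in 𝓝 (0 : E), ∀ t ∈ Set.Icc (0 : ℝ) 1,
    f (x + t • e) = (1 - t) • f x + t • f (x + e)) : SegmentAffineAt f x := by
  refine ⟨0, le_rfl, ?_⟩
  filter_upwards [h] with e he t ht
  rw [he t ht]; simp

lemma const (c : F) (x : E) : SegmentAffineAt (fun _ => c) x :=
  of_eventually_eq (.of_forall fun e t _ => by rw [← add_smul]; simp)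

lemma linear (T : E →L[ℝ] F) (x : E) : SegmentAffineAt (fun v => T v) x :=
  of_eventually_eq (.of_forall fun e t _ => by
    simp only [map_add, map_smul]; module)

lemma add {f₁ f₂ : E → F} {x : E} (h₁ : SegmentAffineAt f₁ x) (h₂ : SegmentAffineAt f₂ x) :
    SegmentAffineAt (fun v => f₁ v + f₂ v) x := by
  obtain ⟨C₁, hC₁, h₁⟩ := h₁
  obtain ⟨C₂, hC₂, h₂⟩ := h₂
  refine ⟨C₁ + C₂, add_nonneg hC₁ hC₂, ?_⟩
  filter_upwards [h₁, h₂] with e h1 h2 t ht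
  have e1 : f₁ (x + t • e) + f₂ (x + t • e) -
      ((1 - t) • (f₁ x + f₂ x) + t • (f₁ (x + e) + f₂ (x + e))) =
      (f₁ (x + t • e) - ((1 - t) • f₁ x + t • f₁ (x + e))) +
      (f₂ (x + t • e) - ((1 - t) • f₂ x + t • f₂ (x + e))) := by module
  rw [e1]
  refine (norm_add_le _ _).trans ?_
  linarith [h1 t ht, h2 t ht]

lemma clm_comp (T : F →L[ℝ] G) {f : E → F} {x : E} (h : SegmentAffineAt f x) :
    SegmentAffineAt (fun v => T (f v)) x := by
  obtain ⟨C, hC, h⟩ := h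
  refine ⟨‖T‖ * C, by positivity, ?_⟩
  filter_upwards [h] with e he t ht
  rw [← map_smul, ← map_smul, ← map_add, ← map_sub]
  refine (T.le_opNorm _).trans ?_
  rw [mul_assoc, mul_assoc]
  gcongr
  rw [← mul_assoc]
  exact he t ht

lemma comp_affine (T : E →L[ℝ] F) (a : F) {f : F → G} {x : E}
    (h : SegmentAffineAt f (a + T x)) : SegmentAffineAt (fun v => f (a + T v)) x := by
  obtain ⟨C, hC, h⟩ := h
  refine ⟨C * ‖T‖ ^ 2, by positivity, ?_⟩
  have hT : Tendsto T (𝓝 0) (𝓝 0) := by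
    have := T.continuous.tendsto 0
    rwa [map_zero] at this
  filter_upwards [hT.eventually h] with e he t ht
  have h1 := he t ht
  rw [map_add, map_add, map_smul, ← add_assoc, ← add_assoc]
  refine h1.trans ?_
  have h2 : ‖T e‖ ^ 2 ≤ (‖T‖ * ‖e‖) ^ 2 := by gcongr; exact T.le_opNorm e
  have h3 : 0 ≤ C * (1 - t) := mul_nonneg hC (by linarith [ht.2])
  nlinarith [mul_le_mul_of_nonneg_left h2 h3]

/-- On the ball of radius `‖e‖` about `x`, `f` minus its linear part at `x` is Lipschitz with
constant `O(‖e‖)`. Comparing with both endpoints, with weights `1 - t` and `t`, produces `t(1 -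
t)‖e‖²` twice. -/
lemma of_contDiffAt {f : E → F} {x : E} (hf : ContDiffAt ℝ 2 f x) : SegmentAffineAt f x := by
  have h1 : ContDiffAt ℝ 1 (fderiv ℝ f) x := hf.fderiv_right (by norm_num)
  obtain ⟨K, s, hs, hK⟩ := h1.exists_lipschitzOnWith
  have hdiff : ∀ᶠ v in 𝓝 x, DifferentiableAt ℝ f v :=
    (hf.eventually (by norm_num)).mono fun v hv => hv.differentiableAt (by norm_num)
  obtain ⟨r, hr, hball⟩ := Metric.eventually_nhds_iff_ball.mp
    (hdiff.and (Filter.eventually_of_mem hs fun v hv => hv))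
  have hx : x ∈ s := mem_of_mem_nhds hs
  refine ⟨2 * K, by positivity, ?_⟩
  filter_upwards [Metric.ball_mem_nhds 0 hr] with e her t ht
  rw [mem_ball_zero_iff] at her
  let k : E → F := fun v => f v - fderiv ℝ f x v
  have hk : ∀ v ∈ Metric.closedBall x ‖e‖,
      HasFDerivWithinAt k (fderiv ℝ f v - fderiv ℝ f x) (Metric.closedBall x ‖e‖) v := by
    intro v hv
    have := (hball v (Metric.closedBall_subset_ball her hv)).1
    exact (this.hasFDerivAt.sub (fderiv ℝ f x).hasFDerivAt).hasFDerivWithinAt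
  have hb : ∀ v ∈ Metric.closedBall x ‖e‖, ‖fderiv ℝ f v - fderiv ℝ f x‖ ≤ K * ‖e‖ := by
    intro v hv
    have h2 := hK.norm_sub_le (hball v (Metric.closedBall_subset_ball her hv)).2 hx
    refine h2.trans ?_
    gcongr
    exact mem_closedBall_iff_norm.mp hv
  have key : ∀ u ∈ Metric.closedBall x ‖e‖, ∀ v ∈ Metric.closedBall x ‖e‖,
      ‖k u - k v‖ ≤ K * ‖e‖ * ‖u - v‖ := fun u hu v hv =>
    (convex_closedBall x ‖e‖).norm_image_sub_le_of_norm_hasFDerivWithin_le hk hb hv hu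
  have mx : x ∈ Metric.closedBall x ‖e‖ := Metric.mem_closedBall_self (norm_nonneg _)
  have me : x + e ∈ Metric.closedBall x ‖e‖ := by simp
  have mt : x + t • e ∈ Metric.closedBall x ‖e‖ := by
    rw [mem_closedBall_iff_norm, add_sub_cancel_left, norm_smul, Real.norm_of_nonneg ht.1]
    exact mul_le_of_le_one_left (norm_nonneg _) ht.2
  have k1 := key _ mt _ mx
  have k2 := key _ mt _ me
  have e1 : x + t • e - (x + e) = (-(1 - t)) • e := by module
  rw [add_sub_cancel_left, norm_smul, Real.norm_of_nonneg ht.1] at k1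
  have h1t : 0 ≤ 1 - t := by linarith [ht.2]
  rw [e1, norm_smul, norm_neg, Real.norm_of_nonneg h1t] at k2
  have e2 : f (x + t • e) - ((1 - t) • f x + t • f (x + e)) =
      (1 - t) • (k (x + t • e) - k x) + t • (k (x + t • e) - k (x + e)) := by
    simp only [k, map_add, map_smul]
    module
  rw [e2]
  refine (norm_add_le _ _).trans ?_
  rw [norm_smul, norm_smul, Real.norm_of_nonneg ht.1, Real.norm_of_nonneg h1t]
  have k3 := mul_le_mul_of_nonneg_left k1 h1t
  have k4 := mul_le_mul_of_nonneg_left k2 ht.1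
  have h5 : 0 ≤ K * (1 - t) * ‖e‖ ^ 2 := by positivity
  nlinarith [ht.2]

/-- Away from the kink the map is locally `f` or `0`. At the kink, where `f x = 0`, positive
homogeneity lets `max · 0` commute with the interpolation, and `max · 0` is 1-Lipschitz. -/
lemma max_zero {f : E → ℝ} {x : E} (h : SegmentAffineAt f x) (hc : ContinuousAt f x) :
    SegmentAffineAt (fun v => max (f v) 0) x := by
  rcases lt_trichotomy (f x) 0 with h0 | h0 | h0
  · refine (const (0 : ℝ) x).congr ?_
    filter_upwards [hc.eventually_lt_const h0] with v hv
    exact (max_eq_right hv.le).symm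
  · obtain ⟨C, hC, h⟩ := h
    refine ⟨C, hC, ?_⟩
    filter_upwards [h] with e he t ht
    have h1 := he t ht
    have h2 : (1 - t) • max (f x) 0 + t • max (f (x + e)) 0 =
        max ((1 - t) • f x + t • f (x + e)) 0 := by
      simp [h0, mul_max_of_nonneg _ _ ht.1]
    rw [h2]
    refine le_trans ?_ h1
    simp only [Real.norm_eq_abs]
    exact abs_max_sub_max_le_abs _ _ _
  · refine h.congr ?_
    filter_upwards [hc.eventually_const_lt h0] with v hv
    exact (max_eq_left hv.le).symm

/-- Interpolation and product differ by `t(1 - t)(f (x + e) - f x) T e`, which the Lipschitz bound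
at `x` makes `O((1 - t)‖e‖²)`. -/
lemma mul_clm {f : E → ℝ} {x : E} (h : SegmentAffineAt f x) (T : E →L[ℝ] ℝ) {K : ℝ}
    (hK : ∀ᶠ v in 𝓝 x, |f v - f x| ≤ K * ‖v - x‖) :
    SegmentAffineAt (fun v => f v * T v) x := by
  obtain ⟨C, hC, h⟩ := h
  refine ⟨C * (|T x| + ‖T‖) + |K| * ‖T‖, by positivity, ?_⟩
  have hx : Tendsto (fun e => x + e) (𝓝 0) (𝓝 x) := by
    have : Tendsto (fun e => x + e) (𝓝 0) (𝓝 (x + 0)) :=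
      (continuous_const.add continuous_id).tendsto 0
    rwa [add_zero] at this
  filter_upwards [h, hx.eventually hK, Metric.ball_mem_nhds 0 one_pos] with e h1 h2 h3 t ht
  rw [mem_ball_zero_iff] at h3
  have h1t : 0 ≤ 1 - t := by linarith [ht.2]
  have h4 := h1 t ht
  rw [add_sub_cancel_left] at h2
  simp only [smul_eq_mul, Real.norm_eq_abs, map_add, map_smul] at h4 ⊢
  set a := f (x + t • e)
  set a0 := f x
  set a1 := f (x + e)
  have e1 : a * (T x + t * T e) - ((1 - t) * (a0 * T x) + t * (a1 * (T x + T e))) =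
      (a - ((1 - t) * a0 + t * a1)) * (T x + t * T e) - (1 - t) * t * ((a1 - a0) * T e) := by
    ring
  rw [e1]
  have hTe : |T e| ≤ ‖T‖ * ‖e‖ := T.le_opNorm e
  have h5 : |T x + t * T e| ≤ |T x| + ‖T‖ := by
    refine (abs_add_le _ _).trans ?_
    rw [abs_mul, abs_of_nonneg ht.1]
    have : t * |T e| ≤ 1 * (‖T‖ * 1) := by
      gcongr
      · exact ht.2
      · exact hTe.trans (by gcongr)
    linarith
  have h6 : |a1 - a0| ≤ |K| * ‖e‖ := h2.trans (by gcongr; exact le_abs_self _)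
  refine (abs_sub _ _).trans ?_
  rw [abs_mul, abs_mul ((1 - t) * t), abs_mul (a1 - a0), abs_of_nonneg (mul_nonneg h1t ht.1)]
  calc |a - ((1 - t) * a0 + t * a1)| * |T x + t * T e| + (1 - t) * t * (|a1 - a0| * |T e|)
      ≤ (C * (1 - t) * ‖e‖ ^ 2) * (|T x| + ‖T‖) +
          (1 - t) * 1 * ((|K| * ‖e‖) * (‖T‖ * ‖e‖)) := by
        gcongr
        exact ht.2
    _ = _ := by ring

lemma pi {n : ℕ} {f : E → Vec n} {x : E} (h : ∀ i, SegmentAffineAt (fun v => f v i) x) :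
    SegmentAffineAt f x := by
  choose C hC h using h
  refine ⟨∑ i, C i, Finset.sum_nonneg fun i _ => hC i, ?_⟩
  filter_upwards [eventually_all.mpr h] with e he t ht
  have hle : ∀ v : Vec n, ‖v‖ ≤ ∑ i, ‖v i‖ := by
    intro v
    rw [EuclideanSpace.norm_eq]
    refine Real.sqrt_le_iff.mpr ⟨Finset.sum_nonneg fun i _ => norm_nonneg _, ?_⟩
    exact Finset.sum_sq_le_sq_sum_of_nonneg fun i _ => norm_nonneg _
  refine (hle _).trans ?_
  rw [Finset.sum_mul, Finset.sum_mul]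
  refine Finset.sum_le_sum fun i _ => ?_
  simpa using he i t ht

/-- The defining estimate of strong semismoothness at nearby points of differentiability. -/
lemma fderiv_estimate {f : E → F} {x : E} (h : SegmentAffineAt f x) :
    ∃ C : ℝ, ∀ᶠ u in 𝓝 x, DifferentiableAt ℝ f u →
      ‖f u - f x - fderiv ℝ f u (u - x)‖ ≤ C * ‖u - x‖ ^ 2 := by
  obtain ⟨C, hC, h⟩ := h
  refine ⟨C, ?_⟩
  have hx : Tendsto (fun u => u - x) (𝓝 x) (𝓝 0) := by
    have : Tendsto (fun u => u - x) (𝓝 x) (𝓝 (x - x)) :=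
      (continuous_id.sub continuous_const).tendsto x
    rwa [sub_self] at this
  filter_upwards [hx.eventually h] with u hu hd
  set e := u - x with he
  have hxe : x + e = u := by rw [he]; abel
  -- `φ` vanishes at `1` and its derivative there is minus the quantity to be bounded; the
  -- hypothesis bounds the slopes from the left by `C‖e‖²`.
  let φ : ℝ → F := fun t => f (x + t • e) - ((1 - t) • f x + t • f u)
  have hφ1 : φ 1 = 0 := by simp [φ, hxe]
  have hφ : HasDerivAt φ (-(f u - f x - fderiv ℝ f u e)) 1 := by
    have hl : HasDerivAt (fun t : ℝ => x + t • e) e 1 := by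
      simpa using ((hasDerivAt_id (1 : ℝ)).smul_const e).const_add x
    have h1 : HasDerivAt (fun t : ℝ => f (x + t • e)) (fderiv ℝ f u e) 1 := by
      have hd' : HasFDerivAt f (fderiv ℝ f u) (x + (1 : ℝ) • e) := by
        rw [one_smul, hxe]; exact hd.hasFDerivAt
      exact hd'.comp_hasDerivAt 1 hl
    have h2 : HasDerivAt (fun t : ℝ => (1 - t) • f x + t • f u) (f u - f x) 1 := by
      have h3 := ((hasDerivAt_id (1 : ℝ)).const_sub 1).smul_const (f x)
      have h4 := (hasDerivAt_id (1 : ℝ)).smul_const (f u)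
      exact (h3.add h4).congr_deriv (by simp; abel)
    exact (h1.sub h2).congr_deriv (by abel)
  have hs := hφ.tendsto_slope.mono_left (nhdsLT_le_nhdsNE (1 : ℝ))
  rw [← norm_neg]
  refine le_of_tendsto hs.norm ?_
  have h01 : ∀ᶠ t in 𝓝[<] (1 : ℝ), 0 < t :=
    nhdsWithin_le_nhds (lt_mem_nhds one_pos)
  filter_upwards [h01, self_mem_nhdsWithin] with t ht0 ht1
  have ht1 : t < 1 := ht1
  have h5 := hu t ⟨ht0.le, ht1.le⟩
  rw [hxe] at h5
  rw [slope_def_module, hφ1, sub_zero, norm_smul, norm_inv, Real.norm_eq_abs,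
    abs_of_neg (by linarith), inv_mul_le_iff₀ (by linarith)]
  refine h5.trans_eq ?_
  ring

end SegmentAffineAt

/-- The defining estimate of strong semismoothness for the Clarke Jacobian. -/
lemma clarke_estimate {m n : ℕ} {f : Vec m → Vec n} {x : Vec m} (hf : Continuous f)
    (h : SegmentAffineAt f x) :
    ∃ C : ℝ, ∀ᶠ u in 𝓝 x, ∀ A ∈ clarke f u, ‖f u - f x - A (u - x)‖ ≤ C * ‖u - x‖ ^ 2 := by
  obtain ⟨C, hC⟩ := h.fderiv_estimate
  refine ⟨C, ?_⟩
  -- The bound is needed at all differentiability points near `u`; being closed and convex in `A`,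
  -- it then survives limits and convex hulls.
  filter_upwards [eventually_eventually_nhds.mpr hC] with u hu A hA
  have hsub : bouligand f u ⊆ {A | ‖f u - f x - A (u - x)‖ ≤ C * ‖u - x‖ ^ 2} := by
    rintro B ⟨v, hv, hvu, hB⟩
    have h1 : Tendsto (fun k => ‖f (v k) - f x - fderiv ℝ f (v k) (v k - x)‖) atTop
        (𝓝 ‖f u - f x - B (u - x)‖) :=
      ((((hf.tendsto u).comp hvu).sub_const (f x)).sub
        ((isBoundedBilinearMap_apply.continuous.tendsto (B, u - x)).comp
          (Tendsto.prodMk_nhds hB (hvu.sub_const x)))).norm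
    have h2 : Tendsto (fun k => C * ‖v k - x‖ ^ 2) atTop (𝓝 (C * ‖u - x‖ ^ 2)) :=
      ((hvu.sub_const x).norm.pow 2).const_mul C
    refine le_of_tendsto_of_tendsto h1 h2 ?_
    filter_upwards [hvu.eventually hu] with k hk
    exact hk (hv k)
  have hconv : Convex ℝ {A : Vec m →L[ℝ] Vec n |
      ‖f u - f x - A (u - x)‖ ≤ C * ‖u - x‖ ^ 2} := by
    intro A hA B hB a b ha hb hab
    simp only [Set.mem_ofPred_eq] at hA hB ⊢
    have e : f u - f x - (a • A + b • B) (u - x) =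
        a • (f u - f x - A (u - x)) + b • (f u - f x - B (u - x)) := by
      simp only [add_apply, smul_apply]
      have : f u - f x = (a + b) • (f u - f x) := by rw [hab, one_smul]
      nth_rewrite 1 [this]
      module
    rw [e]
    refine (norm_add_le _ _).trans ?_
    rw [norm_smul, norm_smul, Real.norm_of_nonneg ha, Real.norm_of_nonneg hb]
    calc _ ≤ a * (C * ‖u - x‖ ^ 2) + b * (C * ‖u - x‖ ^ 2) := by gcongr
      _ = _ := by rw [← add_mul, hab, one_mul]
  exact convexHull_min hsub hconv hA

/-! ### Proximal maps as gradients -/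

/-- The variational inequality characterizing the proximal point of a convex function. -/
def IsProxPoint {n : ℕ} (f : Vec n → ℝ) (x u : Vec n) : Prop :=
  ∀ v, f u + inner ℝ (x - u) (v - u) ≤ f v

section Prox

variable {n : ℕ} {f : Vec n → ℝ} {P : Vec n → Vec n}

lemma IsProxPoint.quadratic_growth {x u : Vec n} (h : IsProxPoint f x u) (v : Vec n) :
    f u + 1 / 2 * ‖u - x‖ ^ 2 + 1 / 2 * ‖v - u‖ ^ 2 ≤ f v + 1 / 2 * ‖v - x‖ ^ 2 := by
  have h1 := h v
  have e : v - x = (v - u) - (x - u) := by abel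
  rw [e, norm_sub_sq_real (v - u), norm_sub_rev u x, real_inner_comm]
  linarith

/-- Quadratic growth leaves `u` as the only minimizer, so the choice operator in `prox` must select
it. -/
lemma IsProxPoint.prox_eq {x u : Vec n} (h : IsProxPoint f x u) : prox f x = u := by
  have hmin : IsMinOn (fun v : Vec n => f v + 1 / 2 * ‖v - x‖ ^ 2) Set.univ u := by
    intro v _
    have := h.quadratic_growth v
    have h2 : 0 ≤ 1 / 2 * ‖v - u‖ ^ 2 := by positivity
    simp only [Set.mem_ofPred_eq]
    linarith
  have hp : IsMinOn (fun v : Vec n => f v + 1 / 2 * ‖v - x‖ ^ 2) Set.univ (prox f x) :=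
    Classical.epsilon_spec (p := fun u : Vec n =>
      IsMinOn (fun v : Vec n => f v + 1 / 2 * ‖v - x‖ ^ 2) Set.univ u) ⟨u, hmin⟩
  have h1 : f (prox f x) + 1 / 2 * ‖prox f x - x‖ ^ 2 ≤ f u + 1 / 2 * ‖u - x‖ ^ 2 :=
    hp (Set.mem_univ u)
  have h2 := h.quadratic_growth (prox f x)
  have h3 : ‖prox f x - u‖ ^ 2 ≤ 0 := by linarith
  exact sub_eq_zero.mp (norm_eq_zero.mp (pow_eq_zero_iff two_ne_zero |>.mp
    (le_antisymm h3 (by positivity))))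

lemma exists_isProxPoint (hf : ConvexOn ℝ Set.univ f) (hc : Continuous f) (h0 : ∀ v, 0 ≤ f v)
    (x : Vec n) : ∃ u, IsProxPoint f x u := by
  have hcont : Continuous fun v : Vec n => f v + 1 / 2 * ‖v - x‖ ^ 2 := by fun_prop
  have hco : Tendsto (fun v : Vec n => f v + 1 / 2 * ‖v - x‖ ^ 2) (cocompact (Vec n)) atTop := by
    have h1 : Tendsto (fun v : Vec n => ‖v‖ + (-‖x‖ - 1 / 2)) (cocompact (Vec n)) atTop :=
      tendsto_atTop_add_const_right _ _ tendsto_norm_cocompact_atTop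
    refine tendsto_atTop_mono (fun v => ?_) h1
    have h2 : ‖v‖ - ‖x‖ ≤ ‖v - x‖ := norm_sub_norm_le v x
    nlinarith [h0 v, sq_nonneg (‖v - x‖ - 1)]
  obtain ⟨u, hu⟩ := hcont.exists_forall_le hco
  refine ⟨u, fun v => ?_⟩
  -- Minimality of `u` tested at `u + t(v - u)` and divided by `t`; the variational inequality is
  -- the limit `t → 0`.
  have key : ∀ t : ℝ, 0 < t → t ≤ 1 →
      0 ≤ (f v - f u - inner ℝ (x - u) (v - u)) + t * (1 / 2 * ‖v - u‖ ^ 2) := by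
    intro t ht ht1
    have h1 := hu (u + t • (v - u))
    have h2 := hf.2 (Set.mem_univ u) (Set.mem_univ v) (by linarith : 0 ≤ 1 - t) ht.le (by ring)
    have e1 : (1 - t) • u + t • v = u + t • (v - u) := by module
    have e2 : u + t • (v - u) - x = t • (v - u) - (x - u) := by abel
    rw [e1] at h2
    rw [e2, norm_sub_sq_real (t • (v - u)), norm_smul, Real.norm_of_nonneg ht.le, inner_smul_left,
      norm_sub_rev u x, real_inner_comm] at h1
    simp only [smul_eq_mul, conj_trivial] at h1 h2
    refine le_of_mul_le_mul_left ?_ ht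
    nlinarith
  have hlim : Tendsto (fun t : ℝ => (f v - f u - inner ℝ (x - u) (v - u)) +
      t * (1 / 2 * ‖v - u‖ ^ 2)) (𝓝[>] 0) (𝓝 (f v - f u - inner ℝ (x - u) (v - u))) := by
    have : Tendsto (fun t : ℝ => (f v - f u - inner ℝ (x - u) (v - u)) +
      t * (1 / 2 * ‖v - u‖ ^ 2)) (𝓝 0) (𝓝 ((f v - f u - inner ℝ (x - u) (v - u)) +
        0 * (1 / 2 * ‖v - u‖ ^ 2))) :=
      (continuous_const.add (continuous_id.mul continuous_const)).tendsto 0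
    rw [zero_mul, add_zero] at this
    exact this.mono_left nhdsWithin_le_nhds
  have hpos := ge_of_tendsto hlim (b := 0) (by
    filter_upwards [Ioc_mem_nhdsGT (one_pos : (0 : ℝ) < 1)] with t ht
    exact key t ht.1 ht.2)
  linarith

/-- The conjugate of `f + ½‖·‖²`, written in terms of the proximal mapping of `f`. -/
def conjEnvelope (f : Vec n → ℝ) (P : Vec n → Vec n) (x : Vec n) : ℝ :=
  inner ℝ (P x) x - f (P x) - 1 / 2 * ‖P x‖ ^ 2

lemma le_conjEnvelope (hP : ∀ x, IsProxPoint f x (P x)) (x v : Vec n) :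
    inner ℝ v x - f v - 1 / 2 * ‖v‖ ^ 2 ≤ conjEnvelope f P x := by
  have h := (hP x).quadratic_growth v
  rw [norm_sub_sq_real (P x) x, norm_sub_sq_real v x] at h
  have : 0 ≤ 1 / 2 * ‖v - P x‖ ^ 2 := by positivity
  unfold conjEnvelope
  linarith

lemma conjEnvelope_lower (hP : ∀ x, IsProxPoint f x (P x)) (x z : Vec n) :
    conjEnvelope f P x + inner ℝ (P x) (z - x) ≤ conjEnvelope f P z := by
  have h := le_conjEnvelope hP z (P x)
  rw [inner_sub_right]
  unfold conjEnvelope at h ⊢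
  linarith

lemma prox_firmly_nonexpansive (hP : ∀ x, IsProxPoint f x (P x)) (x z : Vec n) :
    ‖P x - P z‖ ^ 2 ≤ inner ℝ (P x - P z) (x - z) := by
  have h1 := hP x (P z)
  have h2 := hP z (P x)
  have e : (inner ℝ (x - P x) (P z - P x) : ℝ) + inner ℝ (z - P z) (P x - P z) =
      ‖P x - P z‖ ^ 2 - inner ℝ (P x - P z) (x - z) := by
    rw [← real_inner_self_eq_norm_sq, ← neg_sub (P x) (P z), inner_neg_right,
      ← inner_neg_left, ← inner_add_left, real_inner_comm (x - z), ← inner_sub_left]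
    congr 1
    abel
  linarith

lemma prox_nonexpansive (hP : ∀ x, IsProxPoint f x (P x)) (x z : Vec n) :
    ‖P x - P z‖ ≤ ‖x - z‖ := by
  have h := (prox_firmly_nonexpansive hP x z).trans (real_inner_le_norm _ _)
  by_contra hlt
  push Not at hlt
  nlinarith [norm_nonneg (x - z)]

lemma continuous_prox (hP : ∀ x, IsProxPoint f x (P x)) : Continuous P :=
  (LipschitzWith.of_dist_le_mul (K := 1) fun x z => by
    simpa [dist_eq_norm] using prox_nonexpansive hP x z).continuous

/-- The subgradient inequalities at `x` and `z` trap the first order remainder between `0` and `⟨P z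
- P x, z - x⟩ ≤ ‖z - x‖²`. -/
lemma hasGradientAt_conjEnvelope (hP : ∀ x, IsProxPoint f x (P x)) (x : Vec n) :
    HasGradientAt (conjEnvelope f P) (P x) x := by
  rw [hasGradientAt_iff_isLittleO]
  refine Asymptotics.IsBigO.trans_isLittleO ?_ (Asymptotics.isLittleO_pow_sub_sub x one_lt_two)
  refine Asymptotics.IsBigO.of_bound 1 (.of_forall fun z => ?_)
  have h1 := conjEnvelope_lower hP x z
  have h2 := conjEnvelope_lower hP z x
  have h3 : (inner ℝ (P z - P x) (z - x) : ℝ) ≤ ‖z - x‖ ^ 2 := by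
    refine (real_inner_le_norm _ _).trans ?_
    rw [sq]
    gcongr
    exact prox_nonexpansive hP z x
  rw [inner_sub_left] at h3
  rw [← neg_sub z x, inner_neg_right] at h2
  rw [one_mul, Real.norm_of_nonneg (by linarith), Real.norm_of_nonneg (by positivity)]
  linarith

/-- `P` is a gradient, so its derivative is a Hessian; symmetry of second derivatives needs
differentiability of `P` only at `x`. -/
lemma fderiv_prox_symmetric (hP : ∀ x, IsProxPoint f x (P x)) {x : Vec n}
    (hd : DifferentiableAt ℝ P x) (u v : Vec n) :
    (inner ℝ (fderiv ℝ P x u) v : ℝ) = inner ℝ u (fderiv ℝ P x v) := by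
  have h1 : HasFDerivAt (fun z => innerSL ℝ (P z)) ((innerSL ℝ).comp (fderiv ℝ P x)) x :=
    (innerSL ℝ (E := Vec n)).hasFDerivAt.comp x hd.hasFDerivAt
  have h2 : ∀ᶠ z in 𝓝 x, HasFDerivAt (conjEnvelope f P) (innerSL ℝ (P z)) z :=
    .of_forall fun z => (hasGradientAt_conjEnvelope hP z).hasFDerivAt
  have h3 := second_derivative_symmetric_of_eventually h2 h1 u v
  rw [real_inner_comm _ u]
  simpa using h3

lemma fderiv_prox_nonneg (hP : ∀ x, IsProxPoint f x (P x)) {x : Vec n}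
    (hd : DifferentiableAt ℝ P x) (u : Vec n) : 0 ≤ (inner ℝ (fderiv ℝ P x u) u : ℝ) := by
  have h1 := (hd.hasFDerivAt.hasLineDerivAt u).tendsto_slope_zero
  refine ge_of_tendsto (h1.inner tendsto_const_nhds) ?_
  filter_upwards [self_mem_nhdsWithin] with t ht
  have h2 := (sq_nonneg _).trans (prox_firmly_nonexpansive hP (x + t • u) x)
  rw [add_sub_cancel_left, inner_smul_right] at h2
  rw [inner_smul_left, conj_trivial]
  have ht : t ≠ 0 := ht
  have : t⁻¹ * inner ℝ (P (x + t • u) - P x) u =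
      (t⁻¹) ^ 2 * (t * inner ℝ (P (x + t • u) - P x) u) := by field_simp
  rw [this]
  positivity

lemma norm_fderiv_prox_le (hP : ∀ x, IsProxPoint f x (P x)) (x : Vec n) :
    ‖fderiv ℝ P x‖ ≤ 1 := by
  have : LipschitzWith 1 P := LipschitzWith.of_dist_le_mul fun x z => by
    simpa [dist_eq_norm] using prox_nonexpansive hP x z
  simpa using norm_fderiv_le_of_lipschitz ℝ this (x₀ := x)

/-- Elements of the Clarke Jacobian of a proximal mapping are symmetric, positive semidefinite
and nonexpansive. -/
lemma clarke_prox (hP : ∀ x, IsProxPoint f x (P x)) {x : Vec n} {A : Vec n →L[ℝ] Vec n}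
    (hA : A ∈ clarke P x) :
    (∀ u v, (inner ℝ (A u) v : ℝ) = inner ℝ u (A v)) ∧ (∀ u, 0 ≤ (inner ℝ (A u) u : ℝ)) ∧
      ‖A‖ ≤ 1 := by
  have hsub : bouligand P x ⊆ {A | (∀ u v, (inner ℝ (A u) v : ℝ) = inner ℝ u (A v)) ∧
      (∀ u, 0 ≤ (inner ℝ (A u) u : ℝ)) ∧ ‖A‖ ≤ 1} := by
    rintro B ⟨z, hz, -, hB⟩
    have hB' : Tendsto (fun k => fderiv ℝ P (z k)) atTop (𝓝 B) := hB
    have happ : ∀ u, Tendsto (fun k => fderiv ℝ P (z k) u) atTop (𝓝 (B u)) := fun u =>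
      ((ContinuousLinearMap.apply ℝ (Vec n) u).continuous.tendsto B).comp hB'
    refine ⟨fun u v => ?_, fun u => ?_, ?_⟩
    · refine tendsto_nhds_unique ((happ u).inner tendsto_const_nhds) ?_
      simp only [fderiv_prox_symmetric hP (hz _)]
      exact tendsto_const_nhds.inner (happ v)
    · exact ge_of_tendsto' ((happ u).inner tendsto_const_nhds)
        fun k => fderiv_prox_nonneg hP (hz k) u
    · exact le_of_tendsto' hB'.norm fun k => norm_fderiv_prox_le hP (z k)
  refine convexHull_min hsub ?_ hA
  rintro A ⟨hA1, hA2, hA3⟩ B ⟨hB1, hB2, hB3⟩ a b ha hb hab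
  refine ⟨fun u v => ?_, fun u => ?_, ?_⟩
  · simp only [add_apply, smul_apply, inner_add_left, inner_add_right, inner_smul_left,
      inner_smul_right, conj_trivial, hA1, hB1]
  · simp only [add_apply, smul_apply, inner_add_left, inner_smul_left, conj_trivial]
    exact add_nonneg (mul_nonneg ha (hA2 u)) (mul_nonneg hb (hB2 u))
  · refine (norm_add_le _ _).trans ?_
    rw [norm_smul, norm_smul, Real.norm_of_nonneg ha, Real.norm_of_nonneg hb]
    nlinarith

end Prox

/-! ### Polyhedral regularizers: the proximal map is affine on short segments -/

section Polyhedral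

variable {n : ℕ} {ι : Type*} [Fintype ι]

/-- The sublinear function `v ↦ ∑ₖ |ℓₖ v|`. -/
def sumAbs (ℓ : ι → Vec n →L[ℝ] ℝ) (v : Vec n) : ℝ := ∑ k, |ℓ k v|

/-- `a` is a subgradient of `sumAbs ℓ` at `u`. -/
def IsSumAbsSubgradient (ℓ : ι → Vec n →L[ℝ] ℝ) (a u : Vec n) : Prop :=
  (∀ v, inner ℝ a v ≤ sumAbs ℓ v) ∧ inner ℝ a u = sumAbs ℓ u

variable {ℓ : ι → Vec n →L[ℝ] ℝ}

lemma sumAbs_nonneg (v : Vec n) : 0 ≤ sumAbs ℓ v := Finset.sum_nonneg fun _ _ => abs_nonneg _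

lemma sumAbs_smul {t : ℝ} (ht : 0 ≤ t) (v : Vec n) : sumAbs ℓ (t • v) = t * sumAbs ℓ v := by
  simp [sumAbs, abs_mul, abs_of_nonneg ht, Finset.mul_sum]

lemma sumAbs_add_le (u v : Vec n) : sumAbs ℓ (u + v) ≤ sumAbs ℓ u + sumAbs ℓ v := by
  simp only [sumAbs, map_add, ← Finset.sum_add_distrib]
  exact Finset.sum_le_sum fun k _ => abs_add_le _ _

lemma continuous_sumAbs : Continuous (sumAbs ℓ) := by
  unfold sumAbs
  fun_prop

lemma convexOn_sumAbs : ConvexOn ℝ Set.univ (sumAbs ℓ) := by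
  refine ⟨convex_univ, fun u _ v _ a b ha hb _ => ?_⟩
  refine (sumAbs_add_le _ _).trans_eq ?_
  rw [sumAbs_smul ha, sumAbs_smul hb]
  rfl

lemma isProxPoint_sumAbs_iff {x u : Vec n} :
    IsProxPoint (sumAbs ℓ) x u ↔ IsSumAbsSubgradient ℓ (x - u) u := by
  constructor
  · intro h
    have h1 := h 0
    have h2 := h ((2 : ℝ) • u)
    have e : (2 : ℝ) • u - u = u := by module
    have h0 : sumAbs ℓ (0 : Vec n) = 0 := by simp [sumAbs]
    rw [h0, zero_sub, inner_neg_right] at h1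
    rw [sumAbs_smul (by norm_num), e] at h2
    have heq : inner ℝ (x - u) u = sumAbs ℓ u := by linarith
    refine ⟨fun v => ?_, heq⟩
    have h3 := h v
    rw [inner_sub_right] at h3
    linarith
  · rintro ⟨h1, h2⟩ v
    have := h1 v
    rw [inner_sub_right]
    linarith

/-- Subgradients persist at points whose sign pattern is coarser. -/
lemma IsSumAbsSubgradient.of_sign {a u z : Vec n} (h : IsSumAbsSubgradient ℓ a u)
    (hpos : ∀ k, 0 < ℓ k z → 0 < ℓ k u) (hneg : ∀ k, ℓ k z < 0 → ℓ k u < 0) :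
    IsSumAbsSubgradient ℓ a z := by
  -- Extending the segment from `z` slightly beyond `u` changes no relevant sign, so `sumAbs` is
  -- affine there; the subgradient inequality at the extended point gives the missing inequality at
  -- `z`.
  have hev : ∀ k, ∀ᶠ ε in 𝓝[>] (0 : ℝ),
      |ℓ k (u + ε • (u - z))| + ε * |ℓ k z| = (1 + ε) * |ℓ k u| := by
    intro k
    have hlim : Tendsto (fun ε : ℝ => ℓ k u + ε * (ℓ k u - ℓ k z)) (𝓝[>] 0) (𝓝 (ℓ k u)) := by
      have : Tendsto (fun ε : ℝ => ℓ k u + ε * (ℓ k u - ℓ k z)) (𝓝 0)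
          (𝓝 (ℓ k u + 0 * (ℓ k u - ℓ k z))) :=
        (continuous_const.add (continuous_id.mul continuous_const)).tendsto 0
      rw [zero_mul, add_zero] at this
      exact this.mono_left nhdsWithin_le_nhds
    simp only [map_add, map_smul, map_sub, smul_eq_mul]
    rcases lt_trichotomy (ℓ k u) 0 with h0 | h0 | h0
    · have hz : ℓ k z ≤ 0 := not_lt.mp fun hc => (hpos k hc).not_gt h0
      filter_upwards [hlim.eventually_lt_const h0] with ε hε
      rw [abs_of_neg hε, abs_of_nonpos hz, abs_of_neg h0]
      ring
    · have hz : ℓ k z = 0 := by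
        rcases lt_trichotomy (ℓ k z) 0 with hc | hc | hc
        · exact absurd (hneg k hc) (by simp [h0])
        · exact hc
        · exact absurd (hpos k hc) (by simp [h0])
      simp [h0, hz]
    · have hz : 0 ≤ ℓ k z := not_lt.mp fun hc => (hneg k hc).not_gt h0
      filter_upwards [hlim.eventually_const_lt h0] with ε hε
      rw [abs_of_pos hε, abs_of_nonneg hz, abs_of_pos h0]
      ring
  obtain ⟨ε, hε, hε0⟩ := ((eventually_all.mpr hev).and self_mem_nhdsWithin).exists
  have hε0 : 0 < ε := hε0
  have hsum : sumAbs ℓ (u + ε • (u - z)) + ε * sumAbs ℓ z = (1 + ε) * sumAbs ℓ u := by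
    simp only [sumAbs, Finset.mul_sum, ← Finset.sum_add_distrib]
    exact Finset.sum_congr rfl fun k _ => hε k
  refine ⟨h.1, le_antisymm (h.1 z) ?_⟩
  have h1 := h.1 (u + ε • (u - z))
  rw [inner_add_right, inner_smul_right, inner_sub_right, h.2] at h1
  refine le_of_mul_le_mul_left ?_ hε0
  linarith

lemma isClosed_isSumAbsSubgradient (u : Vec n) : IsClosed {a | IsSumAbsSubgradient ℓ a u} := by
  have h1 : IsClosed {a : Vec n | ∀ v, inner ℝ a v ≤ sumAbs ℓ v} := by
    rw [Set.ofPred_forall]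
    exact isClosed_iInter fun v =>
      isClosed_le (continuous_id.inner continuous_const) continuous_const
  exact h1.inter (isClosed_eq (continuous_id.inner continuous_const) continuous_const)

lemma isProxPoint_prox_sumAbs (x : Vec n) : IsProxPoint (sumAbs ℓ) x (prox (sumAbs ℓ) x) := by
  obtain ⟨u, hu⟩ := exists_isProxPoint (convexOn_sumAbs (ℓ := ℓ)) continuous_sumAbs sumAbs_nonneg x
  rwa [hu.prox_eq]

/-- The set of subgradients at a point is closed and depends only on the sign pattern. A pattern not
admitting `x - P x` therefore cannot occur at `P z` for `z` near `x`, and there are finitely many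
patterns. -/
lemma eventually_subgradient_prox_sumAbs (x : Vec n) :
    ∀ᶠ z in 𝓝 x, IsSumAbsSubgradient ℓ (x - prox (sumAbs ℓ) x) (prox (sumAbs ℓ) z) := by
  classical
  set P := prox (sumAbs ℓ) with hPdef
  have hP : ∀ z, IsProxPoint (sumAbs ℓ) z (P z) := isProxPoint_prox_sumAbs
  have hc : Continuous P := continuous_prox hP
  have hsub : ∀ z, IsSumAbsSubgradient ℓ (z - P z) (P z) := fun z =>
    isProxPoint_sumAbs_iff.mp (hP z)
  have hsame : ∀ a u v : Vec n, (fun k => SignType.sign (ℓ k u)) = (fun k => SignType.sign (ℓ k v)) →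
      IsSumAbsSubgradient ℓ a u → IsSumAbsSubgradient ℓ a v := by
    intro a u v huv h
    refine h.of_sign (fun k hk => ?_) (fun k hk => ?_)
    · have := congrFun huv k
      simp only [sign_pos hk] at this
      exact sign_eq_one_iff.mp this
    · have := congrFun huv k
      simp only [sign_neg hk] at this
      exact sign_eq_neg_one_iff.mp this
  have key : ∀ s : ι → SignType, ∀ᶠ z in 𝓝 x,
      (fun k => SignType.sign (ℓ k (P z))) = s → IsSumAbsSubgradient ℓ (x - P x) (P z) := by
    intro s
    by_cases hs : ∃ u : Vec n, (fun k => SignType.sign (ℓ k u)) = s ∧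
        ¬ IsSumAbsSubgradient ℓ (x - P x) u
    · obtain ⟨u, hu, hnot⟩ := hs
      have hopen := (isClosed_isSumAbsSubgradient (ℓ := ℓ) u).isOpen_compl.mem_nhds hnot
      have hcont : Tendsto (fun z => z - P z) (𝓝 x) (𝓝 (x - P x)) :=
        (continuous_id.sub hc).tendsto x
      filter_upwards [hcont.eventually hopen] with z hz hzs
      exact absurd (hsame _ _ _ (hzs.trans hu.symm) (hsub z)) hz
    · push Not at hs
      exact .of_forall fun z hz => hs _ hz
  filter_upwards [eventually_all.mpr key] with z hz
  exact hz _ rfl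

/-- The proximal mapping of `sumAbs ℓ` is affine along short segments issuing from any point. -/
lemma segmentAffineAt_prox_sumAbs (x : Vec n) : SegmentAffineAt (prox (sumAbs ℓ)) x := by
  set P := prox (sumAbs ℓ) with hPdef
  have hP : ∀ z, IsProxPoint (sumAbs ℓ) z (P z) := isProxPoint_prox_sumAbs
  have hc : Continuous P := continuous_prox hP
  have hsub : ∀ z, IsSumAbsSubgradient ℓ (z - P z) (P z) := fun z =>
    isProxPoint_sumAbs_iff.mp (hP z)
  -- The converse pairing: nonzero signs at `P x` persist at `P z`, so the subgradients `z - P z`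
  -- are also subgradients at `P x`.
  have hcoarse : ∀ᶠ z in 𝓝 x, IsSumAbsSubgradient ℓ (z - P z) (P x) := by
    have hk : ∀ k, Tendsto (fun z => ℓ k (P z)) (𝓝 x) (𝓝 (ℓ k (P x))) := fun k =>
      ((ℓ k).continuous.comp hc).tendsto x
    have h1 : ∀ k, ∀ᶠ z in 𝓝 x, 0 < ℓ k (P x) → 0 < ℓ k (P z) := fun k => by
      by_cases h : 0 < ℓ k (P x)
      · exact ((hk k).eventually_const_lt h).mono fun z hz _ => hz
      · exact .of_forall fun z hz => absurd hz h
    have h2 : ∀ k, ∀ᶠ z in 𝓝 x, ℓ k (P x) < 0 → ℓ k (P z) < 0 := fun k => by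
      by_cases h : ℓ k (P x) < 0
      · exact ((hk k).eventually_lt_const h).mono fun z hz _ => hz
      · exact .of_forall fun z hz => absurd hz h
    filter_upwards [eventually_all.mpr h1, eventually_all.mpr h2] with z hz1 hz2
    exact (hsub z).of_sign hz1 hz2
  have hx : Tendsto (fun e => x + e) (𝓝 0) (𝓝 x) := by
    have : Tendsto (fun e => x + e) (𝓝 0) (𝓝 (x + 0)) :=
      (continuous_const.add continuous_id).tendsto 0
    rwa [add_zero] at this
  refine SegmentAffineAt.of_eventually_eq ?_
  filter_upwards [hx.eventually hcoarse,
    hx.eventually (eventually_subgradient_prox_sumAbs (ℓ := ℓ) x)] with e h1 h2 t ht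
  have h1t : 0 ≤ 1 - t := by linarith [ht.2]
  -- Each of the subgradients `x - P x`, `(x + e) - P (x + e)` is active at each of the two proximal
  -- points, so their interpolation is a subgradient at the interpolated point.
  apply IsProxPoint.prox_eq
  rw [isProxPoint_sumAbs_iff]
  have h3 := hsub x
  have h4 := hsub (x + e)
  set u := P (x + e)
  set a := x + e - u with ha
  set u0 := P x
  set a0 := x - u0 with ha0
  have e1 : x + t • e - ((1 - t) • u0 + t • u) = (1 - t) • a0 + t • a := by
    rw [ha, ha0]; module
  have hle : ∀ v, inner ℝ ((1 - t) • a0 + t • a) v ≤ sumAbs ℓ v := by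
    intro v
    rw [inner_add_left, inner_smul_left, inner_smul_left, conj_trivial, conj_trivial]
    have h5 := mul_le_mul_of_nonneg_left (h3.1 v) h1t
    have h6 := mul_le_mul_of_nonneg_left (h4.1 v) ht.1
    linarith
  rw [e1]
  refine ⟨hle, le_antisymm (hle _) ?_⟩
  refine (sumAbs_add_le _ _).trans_eq ?_
  have h2' : inner ℝ a0 u = sumAbs ℓ u := h2.2
  rw [sumAbs_smul h1t, sumAbs_smul ht.1]
  simp only [inner_add_left, inner_add_right, inner_smul_left, inner_smul_right, conj_trivial,
    h1.2, h2', h3.2, h4.2]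
  ring

end Polyhedral

/-! ### The Wilcoxon loss as a sum of absolute values -/

section RankLoss

variable {n : ℕ}

/-- The weighted pairwise difference functionals of the Wilcoxon loss. -/
def rankFunctional (k : Fin n × Fin n) : Vec n →L[ℝ] ℝ :=
  (1 / ((n : ℝ) * ((n : ℝ) - 1))) •
    (EuclideanSpace.proj k.1 -
      EuclideanSpace.proj k.2)

lemma rankFunctional_apply (k : Fin n × Fin n) (v : Vec n) :
    rankFunctional k v = 1 / ((n : ℝ) * ((n : ℝ) - 1)) * (v k.1 - v k.2) := rfl

lemma rankLoss_eq_sumAbs : rankLoss (n := n) = sumAbs (rankFunctional (n := n)) := by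
  have hc : 0 ≤ 1 / ((n : ℝ) * ((n : ℝ) - 1)) := by
    rcases Nat.eq_zero_or_pos n with rfl | hn
    · simp
    · have : (1 : ℝ) ≤ n := by exact_mod_cast hn
      exact div_nonneg zero_le_one (mul_nonneg (by positivity) (by linarith))
  ext v
  rw [rankLoss, sumAbs, Fintype.sum_prod_type, Finset.mul_sum]
  refine Finset.sum_congr rfl fun i _ => ?_
  rw [← Finset.add_sum_erase _ _ (Finset.mem_univ i), Finset.mul_sum]
  simp only [rankFunctional_apply, abs_mul, abs_of_nonneg hc, sub_self, abs_zero, mul_zero,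
    zero_add]

end RankLoss

/-! ### Group lasso: block soft thresholding -/

section GroupLasso

variable {p : ℕ}

/-- The Euclidean norm of the subvector with indices in `S`. -/
def blockNorm (S : Finset (Fin p)) (z : Vec p) : ℝ := Real.sqrt (∑ i ∈ S, z i ^ 2)

lemma blockNorm_nonneg (S : Finset (Fin p)) (z : Vec p) : 0 ≤ blockNorm S z := Real.sqrt_nonneg _

lemma blockNorm_sq (S : Finset (Fin p)) (z : Vec p) : blockNorm S z ^ 2 = ∑ i ∈ S, z i ^ 2 :=
  Real.sq_sqrt (Finset.sum_nonneg fun _ _ => sq_nonneg _)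

lemma continuous_blockNorm (S : Finset (Fin p)) : Continuous (blockNorm S) := by
  unfold blockNorm
  fun_prop

lemma apply_eq_zero_of_blockNorm {S : Finset (Fin p)} {z : Vec p} (h : blockNorm S z = 0)
    {i : Fin p} (hi : i ∈ S) : z i = 0 := by
  have h1 := blockNorm_sq S z
  rw [h, zero_pow two_ne_zero] at h1
  have := (Finset.sum_eq_zero_iff_of_nonneg fun j _ => sq_nonneg (z j)).mp h1.symm i hi
  exact pow_eq_zero_iff two_ne_zero |>.mp this

/-- The factor of the block soft thresholding operator. -/
def shrinkFactor (S : Finset (Fin p)) (c : ℝ) (z : Vec p) : ℝ := max (1 - c / blockNorm S z) 0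

/-- On the block, `z - u = (1 - a) z`. Either `a = 0` and `N ≤ c`, or `(1 - a) N = c`;
Cauchy–Schwarz concludes. For `N = 0`, division by zero gives `a = 1`, harmless because `z` vanishes
on `S`. -/
lemma block_subgradient (S : Finset (Fin p)) {c : ℝ} (hc : 0 < c) {z u : Vec p}
    (hu : ∀ i ∈ S, u i = shrinkFactor S c z * z i) (v : Vec p) :
    c * blockNorm S u + ∑ i ∈ S, (z i - u i) * (v i - u i) ≤ c * blockNorm S v := by
  set a := shrinkFactor S c z with ha
  set N := blockNorm S z with hN
  have hN0 : 0 ≤ N := blockNorm_nonneg S z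
  have hNv : 0 ≤ blockNorm S v := blockNorm_nonneg S v
  have ha0 : 0 ≤ a := le_max_right _ _
  have hnu : blockNorm S u = a * N := by
    have : ∑ i ∈ S, u i ^ 2 = a ^ 2 * ∑ i ∈ S, z i ^ 2 := by
      rw [Finset.mul_sum]
      exact Finset.sum_congr rfl fun i hi => by rw [hu i hi]; ring
    rw [blockNorm, this, Real.sqrt_mul (sq_nonneg a), Real.sqrt_sq ha0]; rfl
  have hsum : ∑ i ∈ S, (z i - u i) * (v i - u i) =
      (1 - a) * (∑ i ∈ S, z i * v i - a * N ^ 2) := by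
    rw [hN, blockNorm_sq, Finset.mul_sum, ← Finset.sum_sub_distrib, Finset.mul_sum]
    exact Finset.sum_congr rfl fun i hi => by rw [hu i hi]; ring
  have hcs : ∑ i ∈ S, z i * v i ≤ N * blockNorm S v := Real.sum_mul_le_sqrt_mul_sqrt S _ _
  rw [hnu, hsum]
  rcases hN0.eq_or_lt with h0 | h0
  · have ha1 : a = 1 := by
      rw [ha, shrinkFactor, ← hN, ← h0]; simp
    rw [ha1, ← h0]
    simp only [mul_zero, sub_self, zero_mul, zero_add]
    positivity
  rcases le_total (1 - c / N) 0 with h | h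
  · have ha1 : a = 0 := max_eq_right h
    have hle : N ≤ c := by
      rw [sub_nonpos, le_div_iff₀ h0] at h
      linarith
    rw [ha1]
    have := mul_le_mul_of_nonneg_right hle hNv
    linarith
  · have ha1 : a = 1 - c / N := max_eq_left h
    have hmul : (1 - a) * N = c := by rw [ha1]; field_simp; ring
    have h1a : 0 ≤ 1 - a := by rw [ha1]; simp; positivity
    have h2 := mul_le_mul_of_nonneg_left hcs h1a
    have h3 : (1 - a) * (N * blockNorm S v) = c * blockNorm S v := by rw [← hmul]; ring
    have h4 : (1 - a) * (a * N ^ 2) = c * (a * N) := by rw [← hmul]; ring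
    linarith

/-- Below the threshold the map is locally zero. At or above it the block norm is positive, hence
smooth, and the only kink is that of `max · 0`. -/
lemma segmentAffineAt_shrink {S : Finset (Fin p)} {c : ℝ} (hc : 0 < c) {i : Fin p} (hi : i ∈ S)
    (z : Vec p) : SegmentAffineAt (fun v : Vec p => shrinkFactor S c v * v i) z := by
  rcases lt_or_ge (blockNorm S z) c with hlt | hge
  · refine (SegmentAffineAt.const (0 : ℝ) z).congr ?_
    filter_upwards [(continuous_blockNorm S).continuousAt.eventually_lt_const hlt] with v hv
    rcases (blockNorm_nonneg S v).eq_or_lt with h0 | h0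
    · rw [apply_eq_zero_of_blockNorm h0.symm hi, mul_zero]
    · have : 1 - c / blockNorm S v ≤ 0 := by
        rw [sub_nonpos, le_div_iff₀ h0]; linarith
      rw [shrinkFactor, max_eq_right this, zero_mul]
  · have hpos : 0 < blockNorm S z := hc.trans_le hge
    have hsum : ∑ i ∈ S, z i ^ 2 ≠ 0 := by
      rw [← blockNorm_sq]; positivity
    have hN : ContDiffAt ℝ 2 (blockNorm S) z := by
      have h1 : ContDiff ℝ 2 (fun v : Vec p => ∑ i ∈ S, v i ^ 2) := by fun_prop
      exact h1.contDiffAt.sqrt hsum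
    have ha : ContDiffAt ℝ 2 (fun v => 1 - c / blockNorm S v) z :=
      contDiffAt_const.sub (contDiffAt_const.div hN hpos.ne')
    have hd : DifferentiableAt ℝ (fun v => 1 - c / blockNorm S v) z :=
      ha.differentiableAt (by norm_num)
    obtain ⟨K, hK⟩ := hd.isBigO_sub.bound
    refine ((SegmentAffineAt.of_contDiffAt ha).max_zero hd.continuousAt).mul_clm
      (EuclideanSpace.proj i) (K := K) ?_
    filter_upwards [hK] with v hv
    exact (abs_max_sub_max_le_abs _ _ _).trans hv

variable {g : ℕ} {G : Fin g → Finset (Fin p)} {ω : Fin g → ℝ}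

lemma isProxPoint_prox_groupLasso (hGdisj : ∀ l l', l ≠ l' → Disjoint (G l) (G l'))
    (hGcover : ∀ i, ∃ l, i ∈ G l) (hω : ∀ l, 0 < ω l) (z : Vec p) :
    IsProxPoint (groupLasso G ω) z (prox (groupLasso G ω) z) ∧
      ∀ l, ∀ i ∈ G l, prox (groupLasso G ω) z i = shrinkFactor (G l) (ω l) z * z i := by
  choose grp hgrp using hGcover
  have huniq : ∀ l, ∀ i ∈ G l, grp i = l := fun l i hi => by
    by_contra hne
    exact Finset.disjoint_left.mp (hGdisj _ _ hne) (hgrp i) hi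
  have hfib : ∀ l, G l = Finset.univ.filter fun i => grp i = l := fun l => by
    ext i
    simp only [Finset.mem_filter, Finset.mem_univ, true_and]
    exact ⟨huniq l i, fun h => h ▸ hgrp i⟩
  let u : Vec p := WithLp.toLp 2 fun i => shrinkFactor (G (grp i)) (ω (grp i)) z * z i
  have hu : ∀ l, ∀ i ∈ G l, u i = shrinkFactor (G l) (ω l) z * z i := fun l i hi => by
    rw [← huniq l i hi]
  have hprox : IsProxPoint (groupLasso G ω) z u := by
    intro v
    have h1 : (inner ℝ (z - u) (v - u) : ℝ) =
        ∑ l, ∑ i ∈ G l, (z i - u i) * (v i - u i) := by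
      simp only [hfib]
      rw [Finset.sum_fiberwise, PiLp.inner_apply]
      refine Finset.sum_congr rfl fun i _ => ?_
      simp [mul_comm]
    rw [h1, groupLasso, groupLasso, ← Finset.sum_add_distrib]
    exact Finset.sum_le_sum fun l _ => block_subgradient (G l) (hω l) (hu l) v
  rw [hprox.prox_eq]
  exact ⟨hprox, hu⟩

lemma segmentAffineAt_prox_groupLasso (hGdisj : ∀ l l', l ≠ l' → Disjoint (G l) (G l'))
    (hGcover : ∀ i, ∃ l, i ∈ G l) (hω : ∀ l, 0 < ω l) (z : Vec p) :
    SegmentAffineAt (prox (groupLasso G ω)) z := by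
  refine SegmentAffineAt.pi fun i => ?_
  obtain ⟨l, hl⟩ := hGcover i
  have : (fun v => prox (groupLasso G ω) v i) = fun v => shrinkFactor (G l) (ω l) v * v i := by
    ext v
    exact (isProxPoint_prox_groupLasso hGdisj hGcover hω v).2 l i hl
  rw [this]
  exact segmentAffineAt_shrink (hω l) hl z

end GroupLasso

/-! ### The objective: closed form, gradient and generalized Hessian -/

lemma inner_matMap_transpose {m n : ℕ} (A : Matrix (Fin m) (Fin n) ℝ) (u : Vec n) (v : Vec m) :
    (inner ℝ u (matMap A.transpose v) : ℝ) = inner ℝ (matMap A u) v := by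
  have h : matMap A.transpose v = (Matrix.toEuclideanLin A).adjoint v := by
    rw [← Matrix.toEuclideanLin_conjTranspose_eq_adjoint, Matrix.conjTranspose_eq_transpose_of_trivial]
    rfl
  rw [h, LinearMap.adjoint_inner_right]
  rfl

lemma groupLasso_smul {p g : ℕ} (G : Fin g → Finset (Fin p)) (ω : Fin g → ℝ) {t : ℝ}
    (ht : 0 ≤ t) (β : Vec p) : groupLasso G ω (t • β) = t * groupLasso G ω β := by
  simp only [groupLasso, Finset.mul_sum]
  refine Finset.sum_congr rfl fun l _ => ?_
  have : ∑ i ∈ G l, (t • β) i ^ 2 = t ^ 2 * ∑ i ∈ G l, β i ^ 2 := by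
    simp [Finset.mul_sum, mul_pow]
  rw [this, Real.sqrt_mul (sq_nonneg t), Real.sqrt_sq ht]
  ring

lemma rankLoss_smul {n : ℕ} {t : ℝ} (ht : 0 ≤ t) (v : Vec n) :
    rankLoss (t • v) = t * rankLoss v := by
  rw [rankLoss_eq_sumAbs, sumAbs_smul ht]

lemma isProxPoint_prox_rankLoss {n : ℕ} (x : Vec n) :
    IsProxPoint rankLoss x (prox rankLoss x) := by
  rw [rankLoss_eq_sumAbs]
  exact isProxPoint_prox_sumAbs x

lemma segmentAffineAt_prox_rankLoss {n : ℕ} (x : Vec n) :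
    SegmentAffineAt (prox (rankLoss (n := n))) x := by
  rw [rankLoss_eq_sumAbs]
  exact segmentAffineAt_prox_sumAbs x

section Objective

variable {n p g : ℕ} (X : Matrix (Fin n) (Fin p) ℝ) (y : Vec n)
  (G : Fin g → Finset (Fin p)) (ω : Fin g → ℝ) (lam σ τ : ℝ) (wk sk : Vec n) (βk : Vec p)

/-- The argument of `Prox_L` in the gradient of `psi`. -/
def rankArg (w : Vec n) : Vec n := (1 / σ) • sk + w

/-- The argument of `Prox_Ψ` in the gradient of `psi`. -/
def lassoArg (w : Vec n) : Vec p := (1 / (σ * lam)) • βk - (1 / lam) • matMap X.transpose w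

/-- The gradient of `psi`. -/
def psiGrad (w : Vec n) : Vec n :=
  y + σ • prox rankLoss (rankArg σ sk w)
    - (σ * lam) • matMap X (prox (groupLasso G ω) (lassoArg X lam σ βk w)) + (τ / σ) • (w - wk)

variable {X y G ω lam σ τ wk sk βk}

lemma lassoArg_sub (w v : Vec n) : lassoArg X lam σ βk w - lassoArg X lam σ βk v =
    -((1 / lam) • matMap X.transpose (w - v)) := by
  rw [lassoArg, lassoArg, map_sub]; module

lemma rankArg_sub (w v : Vec n) : rankArg σ sk w - rankArg σ sk v = w - v := by
  rw [rankArg, rankArg]; abel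

/-- The scalings `σ` and `σλ` normalize both penalties to `½‖·‖²`, so the maximization separates
into two conjugates. -/
lemma augLagrangian_summand (hlam : 0 < lam) (hσ : 0 < σ) (w ν : Vec n) (φ : Vec p) :
    lagrangian X y G ω lam w (σ • ν) ((σ * lam) • φ)
      - 1 / (2 * σ) * ‖σ • ν - sk‖ ^ 2 - 1 / (2 * σ) * ‖(σ * lam) • φ - βk‖ ^ 2 =
    inner ℝ y w + σ * (inner ℝ ν (rankArg σ sk w) - rankLoss ν - 1 / 2 * ‖ν‖ ^ 2)
      + σ * lam ^ 2 * (inner ℝ φ (lassoArg X lam σ βk w) - groupLasso G ω φ - 1 / 2 * ‖φ‖ ^ 2)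
      - 1 / (2 * σ) * (‖sk‖ ^ 2 + ‖βk‖ ^ 2) := by
  rw [lagrangian, rankLoss_smul hσ.le, groupLasso_smul G ω (by positivity : 0 ≤ σ * lam),
    norm_sub_sq_real, norm_sub_sq_real, norm_smul, norm_smul, Real.norm_of_nonneg hσ.le,
    Real.norm_of_nonneg (by positivity : 0 ≤ σ * lam), rankArg, lassoArg]
  simp only [inner_add_right, inner_sub_right, inner_smul_left, inner_smul_right, conj_trivial]
  field_simp
  ring

lemma psi_eq (hP : ∀ z, IsProxPoint (groupLasso G ω) z (prox (groupLasso G ω) z))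
    (hlam : 0 < lam) (hσ : 0 < σ) (w : Vec n) :
    psi X y G ω lam σ τ wk sk βk w =
      inner ℝ y w + σ * conjEnvelope rankLoss (prox rankLoss) (rankArg σ sk w)
      + σ * lam ^ 2 * conjEnvelope (groupLasso G ω) (prox (groupLasso G ω))
          (lassoArg X lam σ βk w)
      - 1 / (2 * σ) * (‖sk‖ ^ 2 + ‖βk‖ ^ 2) + τ / (2 * σ) * ‖w - wk‖ ^ 2 := by
  rw [psi, augLagrangian]
  congr 1
  have hle : ∀ q : Vec n × Vec p, lagrangian X y G ω lam w q.1 q.2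
      - 1 / (2 * σ) * ‖q.1 - sk‖ ^ 2 - 1 / (2 * σ) * ‖q.2 - βk‖ ^ 2 ≤
      inner ℝ y w + σ * conjEnvelope rankLoss (prox rankLoss) (rankArg σ sk w)
      + σ * lam ^ 2 * conjEnvelope (groupLasso G ω) (prox (groupLasso G ω))
          (lassoArg X lam σ βk w)
      - 1 / (2 * σ) * (‖sk‖ ^ 2 + ‖βk‖ ^ 2) := by
    rintro ⟨ν, φ⟩
    have hs : σ * lam ≠ 0 := by positivity
    have e1 : ν = σ • (σ⁻¹ • ν) := (smul_inv_smul₀ hσ.ne' ν).symm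
    have e2 : φ = (σ * lam) • ((σ * lam)⁻¹ • φ) := (smul_inv_smul₀ hs φ).symm
    simp only
    rw [e1, e2, augLagrangian_summand hlam hσ]
    gcongr
    · exact le_conjEnvelope isProxPoint_prox_rankLoss _ _
    · exact le_conjEnvelope hP _ _
  refine le_antisymm (ciSup_le hle) ?_
  refine le_trans (le_of_eq ?_) (le_ciSup ⟨_, Set.forall_mem_range.mpr hle⟩
    (σ • prox rankLoss (rankArg σ sk w),
      (σ * lam) • prox (groupLasso G ω) (lassoArg X lam σ βk w)))
  simp only
  rw [augLagrangian_summand hlam hσ]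
  rfl

/-- The two envelopes contribute only their subgradient inequalities; the modulus comes entirely
from the proximal term. -/
lemma psi_strongConvex (hP : ∀ z, IsProxPoint (groupLasso G ω) z (prox (groupLasso G ω) z))
    (hlam : 0 < lam) (hσ : 0 < σ) (w v : Vec n) :
    psi X y G ω lam σ τ wk sk βk w + inner ℝ (psiGrad X y G ω lam σ τ wk sk βk w) (v - w)
      + τ / σ / 2 * ‖v - w‖ ^ 2 ≤ psi X y G ω lam σ τ wk sk βk v := by
  rw [psi_eq hP hlam hσ, psi_eq hP hlam hσ]
  have h1 := conjEnvelope_lower isProxPoint_prox_rankLoss (rankArg σ sk w) (rankArg σ sk v)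
  have h2 := conjEnvelope_lower hP (lassoArg X lam σ βk w) (lassoArg X lam σ βk v)
  rw [rankArg_sub] at h1
  rw [lassoArg_sub, inner_neg_right, inner_smul_right, inner_matMap_transpose] at h2
  have h1' := mul_le_mul_of_nonneg_left h1 hσ.le
  have h2' := mul_le_mul_of_nonneg_left h2 (by positivity : 0 ≤ σ * lam ^ 2)
  have e : v - wk = (v - w) + (w - wk) := by abel
  have e3 : σ * lam ^ 2 * (1 / lam * inner ℝ (matMap X (prox (groupLasso G ω)
      (lassoArg X lam σ βk w))) (v - w)) = σ * lam * inner ℝ (matMap X (prox (groupLasso G ω)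
      (lassoArg X lam σ βk w))) (v - w) := by field_simp
  rw [e, norm_add_sq_real, psiGrad, real_inner_comm (w - wk) (v - w)]
  simp only [inner_add_left, inner_sub_left (y + _), inner_smul_left, conj_trivial]
  rw [inner_sub_right y]
  have e4 : τ / σ / 2 = τ / (2 * σ) := by field_simp
  have e5 : τ / σ = 2 * (τ / (2 * σ)) := by field_simp
  rw [e4, e5]
  rw [mul_add, mul_neg, e3] at h2'
  linarith

lemma hasGradientAt_psi (hP : ∀ z, IsProxPoint (groupLasso G ω) z (prox (groupLasso G ω) z))
    (hlam : 0 < lam) (hσ : 0 < σ) (w : Vec n) :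
    HasGradientAt (psi X y G ω lam σ τ wk sk βk) (psiGrad X y G ω lam σ τ wk sk βk w) w := by
  rw [show psi X y G ω lam σ τ wk sk βk = _ from funext (psi_eq hP hlam hσ)]
  rw [hasGradientAt_iff_hasFDerivAt]
  have h1 : HasFDerivAt (fun w : Vec n => (inner ℝ y w : ℝ)) (innerSL ℝ y) w :=
    (innerSL ℝ y).hasFDerivAt
  have h2 : HasFDerivAt (fun w => rankArg σ sk w) (ContinuousLinearMap.id ℝ (Vec n)) w :=
    (hasFDerivAt_id w).const_add _
  have h3 : HasFDerivAt (fun w => lassoArg X lam σ βk w)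
      (-((1 / lam) • matMap X.transpose)) w :=
    (((1 / lam) • matMap X.transpose).hasFDerivAt).const_sub _
  have h4 := ((hasGradientAt_conjEnvelope isProxPoint_prox_rankLoss
    (rankArg σ sk w)).hasFDerivAt.comp w h2).const_mul σ
  have h5 := ((hasGradientAt_conjEnvelope hP
    (lassoArg X lam σ βk w)).hasFDerivAt.comp w h3).const_mul (σ * lam ^ 2)
  have h6 := (((hasFDerivAt_id w).sub_const wk).norm_sq).const_mul (τ / (2 * σ))
  refine ((((h1.add h4).add h5).sub_const _).add h6).congr_fderiv ?_
  ext v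
  simp only [psiGrad, add_apply, smul_apply, ContinuousLinearMap.comp_apply, neg_apply,
    innerSL_apply_apply, InnerProductSpace.toDual_apply_apply, smul_eq_mul,
    ContinuousLinearMap.id_apply, inner_neg_right, inner_smul_right, inner_matMap_transpose,
    inner_add_left, inner_sub_left (y + _), inner_smul_left, conj_trivial, id_eq]
  field_simp
  ring

lemma lipschitz_psiGrad (hP : ∀ z, IsProxPoint (groupLasso G ω) z (prox (groupLasso G ω) z))
    (hlam : 0 < lam) (hσ : 0 < σ) (hτ : 0 < τ) (w v : Vec n) :
    ‖psiGrad X y G ω lam σ τ wk sk βk w - psiGrad X y G ω lam σ τ wk sk βk v‖ ≤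
      (σ + σ * (‖matMap X‖ * ‖matMap X.transpose‖) + τ / σ) * ‖w - v‖ := by
  have e : psiGrad X y G ω lam σ τ wk sk βk w - psiGrad X y G ω lam σ τ wk sk βk v =
      σ • (prox rankLoss (rankArg σ sk w) - prox rankLoss (rankArg σ sk v)) +
      -((σ * lam) • matMap X (prox (groupLasso G ω) (lassoArg X lam σ βk w) -
        prox (groupLasso G ω) (lassoArg X lam σ βk v))) + (τ / σ) • (w - v) := by
    rw [psiGrad, psiGrad, map_sub]; module
  have h1 := prox_nonexpansive isProxPoint_prox_rankLoss (rankArg σ sk w) (rankArg σ sk v)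
  have h2 := prox_nonexpansive hP (lassoArg X lam σ βk w) (lassoArg X lam σ βk v)
  rw [rankArg_sub] at h1
  rw [lassoArg_sub, norm_neg, norm_smul, Real.norm_of_nonneg (by positivity)] at h2
  rw [e]
  refine norm_add₃_le.trans ?_
  rw [norm_neg, norm_smul, norm_smul, norm_smul, Real.norm_of_nonneg hσ.le,
    Real.norm_of_nonneg (by positivity : 0 ≤ σ * lam),
    Real.norm_of_nonneg (by positivity : 0 ≤ τ / σ)]
  have h3 : ‖matMap X (prox (groupLasso G ω) (lassoArg X lam σ βk w) -
      prox (groupLasso G ω) (lassoArg X lam σ βk v))‖ ≤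
      ‖matMap X‖ * (1 / lam * (‖matMap X.transpose‖ * ‖w - v‖)) := by
    refine ((matMap X).le_opNorm _).trans ?_
    gcongr
    refine h2.trans ?_
    gcongr
    exact (matMap X.transpose).le_opNorm _
  calc _ ≤ σ * ‖w - v‖ + σ * lam * (‖matMap X‖ * (1 / lam * (‖matMap X.transpose‖ * ‖w - v‖)))
        + τ / σ * ‖w - v‖ := by gcongr
    _ = _ := by field_simp

lemma segmentAffineAt_psiGrad (hdisj : ∀ l l', l ≠ l' → Disjoint (G l) (G l'))
    (hcover : ∀ i, ∃ l, i ∈ G l) (hω : ∀ l, 0 < ω l) (x : Vec n) :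
    SegmentAffineAt (psiGrad X y G ω lam σ τ wk sk βk) x := by
  have h1 := ((segmentAffineAt_prox_rankLoss _).comp_affine (ContinuousLinearMap.id ℝ (Vec n))
    ((1 / σ) • sk) (x := x)).clm_comp (σ • ContinuousLinearMap.id ℝ (Vec n))
  have h2 := ((segmentAffineAt_prox_groupLasso hdisj hcover hω _).comp_affine
    (-((1 / lam) • matMap X.transpose)) ((1 / (σ * lam)) • βk) (x := x)).clm_comp
      (-((σ * lam) • matMap X))
  have h3 := SegmentAffineAt.linear ((τ / σ) • ContinuousLinearMap.id ℝ (Vec n)) x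
  have h4 := ((h1.add h2).add h3).add (SegmentAffineAt.const (y - (τ / σ) • wk) x)
  refine h4.congr (.of_forall fun w => ?_)
  simp only [psiGrad, rankArg, lassoArg, smul_apply, neg_apply, ContinuousLinearMap.id_apply,
    ← sub_eq_add_neg]
  module

/-- The Clarke estimate is applied to each proximal map at its own argument and pushed through the
affine maps, so no chain rule for Clarke Jacobians is needed. The factors `-1/λ` and `-σλ` combine
to the `σ` in front of `X V Xᵀ`. -/
lemma genHessian_estimate (hdisj : ∀ l l', l ≠ l' → Disjoint (G l) (G l'))
    (hcover : ∀ i, ∃ l, i ∈ G l) (hω : ∀ l, 0 < ω l) (hlam : 0 < lam) (hσ : 0 < σ) (x : Vec n) :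
    ∃ C : ℝ, ∀ᶠ w in 𝓝 x, ∀ H ∈ genHessian X G ω lam σ τ sk βk w,
      ‖psiGrad X y G ω lam σ τ wk sk βk w - psiGrad X y G ω lam σ τ wk sk βk x - H (w - x)‖ ≤
        C * ‖w - x‖ ^ 2 := by
  have hP : ∀ z, IsProxPoint (groupLasso G ω) z (prox (groupLasso G ω) z) := fun z =>
    (isProxPoint_prox_groupLasso hdisj hcover hω z).1
  obtain ⟨C₁, h₁⟩ := clarke_estimate (continuous_prox isProxPoint_prox_rankLoss)
    (segmentAffineAt_prox_rankLoss (rankArg σ sk x))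
  obtain ⟨C₂, h₂⟩ := clarke_estimate (continuous_prox hP)
    (segmentAffineAt_prox_groupLasso hdisj hcover hω (lassoArg X lam σ βk x))
  have t₁ : Tendsto (rankArg σ sk) (𝓝 x) (𝓝 (rankArg σ sk x)) := by
    have : Continuous (rankArg σ sk) := by unfold rankArg; fun_prop
    exact this.tendsto x
  have t₂ : Tendsto (lassoArg X lam σ βk) (𝓝 x) (𝓝 (lassoArg X lam σ βk x)) := by
    have : Continuous (lassoArg X lam σ βk) := by unfold lassoArg; fun_prop
    exact this.tendsto x
  refine ⟨σ * C₁ + σ * lam * (‖matMap X‖ * (|C₂| * (1 / lam * ‖matMap X.transpose‖) ^ 2)), ?_⟩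
  filter_upwards [t₁.eventually h₁, t₂.eventually h₂] with w hw₁ hw₂ H hH
  obtain ⟨Λ, hΛ, V, hV, rfl⟩ := hH
  have b₁ := hw₁ Λ hΛ
  have b₂ := hw₂ V hV
  rw [rankArg_sub] at b₁
  rw [lassoArg_sub] at b₂
  set r := prox (groupLasso G ω) (lassoArg X lam σ βk w) -
    prox (groupLasso G ω) (lassoArg X lam σ βk x) -
    V (-((1 / lam) • matMap X.transpose (w - x))) with hr
  have e : psiGrad X y G ω lam σ τ wk sk βk w - psiGrad X y G ω lam σ τ wk sk βk x -
      (σ • Λ + σ • ((matMap X).comp (V.comp (matMap X.transpose)))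
        + (τ / σ) • ContinuousLinearMap.id ℝ (Vec n)) (w - x) =
      σ • (prox rankLoss (rankArg σ sk w) - prox rankLoss (rankArg σ sk x) - Λ (w - x)) -
      (σ * lam) • matMap X r := by
    rw [hr]
    simp only [psiGrad, add_apply, smul_apply, ContinuousLinearMap.comp_apply,
      ContinuousLinearMap.id_apply, map_sub, map_neg, map_smul]
    match_scalars <;> field_simp <;> ring
  rw [e]
  refine (norm_sub_le _ _).trans ?_
  rw [norm_smul, norm_smul, Real.norm_of_nonneg hσ.le,
    Real.norm_of_nonneg (by positivity : 0 ≤ σ * lam)]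
  have b₃ : ‖r‖ ≤ |C₂| * (1 / lam * (‖matMap X.transpose‖ * ‖w - x‖)) ^ 2 := by
    refine b₂.trans ?_
    rw [norm_neg, norm_smul, Real.norm_of_nonneg (by positivity : 0 ≤ 1 / lam)]
    gcongr
    · exact le_abs_self _
    · exact (matMap X.transpose).le_opNorm _
  have b₄ : ‖matMap X r‖ ≤
      ‖matMap X‖ * (|C₂| * (1 / lam * (‖matMap X.transpose‖ * ‖w - x‖)) ^ 2) :=
    ((matMap X).le_opNorm r).trans (by gcongr)
  calc _ ≤ σ * (C₁ * ‖w - x‖ ^ 2) + σ * lam *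
        (‖matMap X‖ * (|C₂| * (1 / lam * (‖matMap X.transpose‖ * ‖w - x‖)) ^ 2)) := by gcongr
    _ = _ := by ring

lemma genHessian_bounds (hP : ∀ z, IsProxPoint (groupLasso G ω) z (prox (groupLasso G ω) z))
    (hσ : 0 < σ) (hτ : 0 < τ) {w : Vec n} {H : Vec n →L[ℝ] Vec n}
    (hH : H ∈ genHessian X G ω lam σ τ sk βk w) :
    (∀ u v, (inner ℝ (H u) v : ℝ) = inner ℝ u (H v)) ∧
    (∀ u, τ / σ * ‖u‖ ^ 2 ≤ inner ℝ (H u) u) ∧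
    ∀ u, ‖H u‖ ≤ (σ + σ * (‖matMap X‖ * ‖matMap X.transpose‖) + τ / σ) * ‖u‖ := by
  obtain ⟨Λ, hΛ, V, hV, rfl⟩ := hH
  obtain ⟨a1, a2, a3⟩ := clarke_prox isProxPoint_prox_rankLoss hΛ
  obtain ⟨b1, b2, b3⟩ := clarke_prox hP hV
  simp only [add_apply, smul_apply, ContinuousLinearMap.comp_apply, ContinuousLinearMap.id_apply]
  refine ⟨fun u v => ?_, fun u => ?_, fun u => ?_⟩
  · have h : (inner ℝ (matMap X (V (matMap X.transpose u))) v : ℝ) =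
        inner ℝ u (matMap X (V (matMap X.transpose v))) := by
      rw [← inner_matMap_transpose, b1, ← real_inner_comm u, ← inner_matMap_transpose,
        real_inner_comm, Matrix.transpose_transpose]
    simp only [inner_add_left, inner_add_right, inner_smul_left, inner_smul_right, conj_trivial,
      a1, h]
  · simp only [inner_add_left, inner_smul_left, conj_trivial, ← inner_matMap_transpose,
      real_inner_self_eq_norm_sq]
    have h1 := mul_nonneg hσ.le (a2 u)
    have h2 := mul_nonneg hσ.le (b2 (matMap X.transpose u))
    linarith
  · refine norm_add₃_le.trans ?_
    rw [norm_smul, norm_smul, norm_smul, Real.norm_of_nonneg hσ.le,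
      Real.norm_of_nonneg (by positivity : 0 ≤ τ / σ)]
    have h1 : ‖Λ u‖ ≤ 1 * ‖u‖ := Λ.le_of_opNorm_le a3 u
    have h2 : ‖matMap X (V (matMap X.transpose u))‖ ≤
        ‖matMap X‖ * (1 * (‖matMap X.transpose‖ * ‖u‖)) := by
      refine ((matMap X).le_opNorm _).trans ?_
      gcongr
      refine (V.le_of_opNorm_le b3 _).trans ?_
      gcongr
      exact (matMap X.transpose).le_opNorm u
    calc _ ≤ σ * (1 * ‖u‖) + σ * (‖matMap X‖ * (1 * (‖matMap X.transpose‖ * ‖u‖))) +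
          τ / σ * ‖u‖ := by gcongr
      _ = _ := by ring

end Objective
end RankSSN

end

theorem theorem3 {n p g : ℕ} (hn : 2 ≤ n)
    (X : Matrix (Fin n) (Fin p) ℝ) (y : RankSSN.Vec n)
    (G : Fin g → Finset (Fin p))
    (hGdisj : ∀ l l', l ≠ l' → Disjoint (G l) (G l'))
    (hGcover : ∀ i, ∃ l, i ∈ G l)
    (ω : Fin g → ℝ) (hω : ∀ l, 0 < ω l)
    (lam σ τ : ℝ) (hlam : 0 < lam) (hσ : 0 < σ) (hτ : 0 < τ)
    (wk sk : RankSSN.Vec n) (βk : RankSSN.Vec p)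
    (μ η θ δ : ℝ) (hμ : μ ∈ Set.Ioo (0 : ℝ) (1 / 2)) (hη : η ∈ Set.Ioo (0 : ℝ) 1)
    (hθ : θ ∈ Set.Ioc (0 : ℝ) 1) (hδ : δ ∈ Set.Ioo (0 : ℝ) 1)
    (w : ℕ → RankSSN.Vec n)
    (hw : RankSSN.IsSSNSequence X y G ω lam σ τ wk sk βk μ η θ δ w) :
    ∃ wbar : RankSSN.Vec n,
      (∀ v, IsMinOn (RankSSN.psi X y G ω lam σ τ wk sk βk) Set.univ v ↔ v = wbar) ∧
      Tendsto w atTop (𝓝 wbar) ∧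
      (fun j => ‖w (j + 1) - wbar‖) =O[atTop] (fun j => ‖w j - wbar‖ ^ (1 + θ)) := by
  have hP : ∀ z, RankSSN.IsProxPoint (RankSSN.groupLasso G ω) z
      (RankSSN.prox (RankSSN.groupLasso G ω) z) := fun z =>
    (RankSSN.isProxPoint_prox_groupLasso hGdisj hGcover hω z).1
  exact RankSSN.newton_convergence (by positivity : 0 < τ / σ)
    (by positivity : 0 < σ + σ * (‖RankSSN.matMap X‖ * ‖RankSSN.matMap X.transpose‖) + τ / σ)
    hμ hη.2 hθ hδ (RankSSN.hasGradientAt_psi hP hlam hσ) (RankSSN.psi_strongConvex hP hlam hσ)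
    (RankSSN.lipschitz_psiGrad hP hlam hσ hτ)
    (fun _ _ hH => (RankSSN.genHessian_bounds hP hσ hτ hH).1)
    (fun _ _ hH => (RankSSN.genHessian_bounds hP hσ hτ hH).2.1)
    (fun _ _ hH => (RankSSN.genHessian_bounds hP hσ hτ hH).2.2)
    (RankSSN.segmentAffineAt_psiGrad hGdisj hGcover hω)
    (RankSSN.genHessian_estimate hGdisj hGcover hω hlam hσ) hw.step
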